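/- Let $d',d''\ge 1$, $d=d'+d''$, $D=d'+2d''$, and write $x=(x',x'')\in\mathbb R^d=\mathbb R^{d'}\times\mathbb R^{d''}$. Let $h_k$, $k\in\mathbb N^{d'}$ (with $0\in\mathbb N$), be the $L^2$-normalized Hermite functions on $\mathbb R^{d'}$, $|k|=k_1+\dots+k_{d'}$, and for $\tau>0$ let $h_{k,\tau}(x')=\tau^{d'/4}h_k(\tau^{1/2}x')$. Let $\mathcal F''$ be the unitary Fourier transform on $L^2(\mathbb R^{d''})$ extending $\mathcal F''u(\xi'')=(2\pi)^{-d''/2}\int_{\mathbb R^{d''}} u(x'')e^{-i\xi''\cdot x''}\,dx''$, and let $L^2(\Gamma)=L^2(\mathbb N^{d'}\times\mathbb R^{d''})$ with respect to the product of counting measure and Lebesgue measure. For $f\in L^2(\mathbb R^d)$ put $$\mathcal Gf(k,\xi'')=\int_{\mathbb R^{d'}}\mathcal F''[f(x',\cdot)](\xi'')\,h_{k,|\xi''|}(x')\,dx'$$ for every $k$ and almost every $\xi''$, and for $F\in L^2(\Gamma)$ put $$\mathcal G^{-1}F(x',\cdot)=\mathcal F''^{-1}\Big[\xi''\mapsto\sum_{k\in\mathbb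 N^{d'}}F(k,\xi'')h_{k,|\xi''|}(x')\Big]$$ for almost every $x'$, where for almost every $\xi''$ the series converges in $L^2(\mathbb R^{d'})$. Let $\Theta(k,\xi'')=(2|k|+d')|\xi''|$, and for $t>0$ define $\exp(-t\mathbb G)=\mathcal G^{-1}\circ M_{e^{-t\Theta}}\circ\mathcal G$, where $M_{e^{-t\Theta}}$ is multiplication by $e^{-t\Theta}$ on $L^2(\Gamma)$. Theorem. For every $t>0$, $\exp(-t\mathbb G)$ is a well-defined operator on all of $L^2(\mathbb R^d)$ and it is an integral operator with the measurable kernel $$p_t(x,y)=(2\pi t)^{-D/2}\int_{\mathbb R^{d''}}e^{\frac it(x''-y'')\cdot\xi''}\exp\Big(-\frac{|\xi''|}{4t}\big(|x'+y'|^2\tanh|\xi''|+|x'-y'|^2\coth|\xi''|\big)\Big)\Big(\frac{|\xi''|}{\sinh 2|\xi''|}\Big)^{d'/2}d\xi'',$$ where the integral converges absolutely for all $x,y\in\mathbb R^d$. That is, for every $f\in L^2(\mathbb R^d)$ the function $p_t(x,\cdot)f$ is integrable on $\mathbb R^d$ for every $x\in\mathbb R^d$, and $$\exp(-t\mathbb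 G)f(x)=\int_{\mathbb R^d}p_t(x,y)f(y)\,dy\qquad\text{for almost every }x\in\mathbb R^d.$$ -/

import Mathlib

open MeasureTheory Filter Topology FourierTransform

noncomputable section

namespace Grushin

/-- The Euclidean space `ℝⁿ`. -/
abbrev E (n : ℕ) : Type := EuclideanSpace ℝ (Fin n)

/-- `L²(ℝᵈ)`, where `ℝᵈ = ℝᵐ × ℝⁿ` carries Lebesgue measure (`m = d'`, `n = d''`). -/
abbrev L2 (m n : ℕ) : Type := Lp (α := E m × E n) ℂ 2 volume

/-- The measure on `Γ = ℕᵐ × ℝⁿ`: counting measure times Lebesgue measure. -/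
def gammaMeasure (m n : ℕ) : Measure ((Fin m → ℕ) × E n) :=
  (Measure.count : Measure (Fin m → ℕ)).prod volume

/-- `L²(Γ)`. -/
abbrev L2Γ (m n : ℕ) : Type := Lp (α := (Fin m → ℕ) × E n) ℂ 2 (gammaMeasure m n)

/-! ### Hermite functions -/

/-- The one-dimensional `L²`-normalized Hermite function
`h_j(u) = (2ʲ j! √π)^(-1/2) H_j(u) exp(-u²/2)`. Here `H_j` is the physicists' Hermite polynomial;
in terms of Mathlib's (probabilists') `He_j` one has `H_j(u) = 2^(j/2) He_j(√2 u)`. -/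
def hermiteFun (j : ℕ) (u : ℝ) : ℝ :=
  (Real.sqrt ((j.factorial : ℝ) * Real.sqrt Real.pi))⁻¹ *
    Polynomial.aeval (Real.sqrt 2 * u) (Polynomial.hermite j) * Real.exp (-u ^ 2 / 2)

/-- The Hermite function `h_k` on `ℝᵐ`, `k ∈ ℕᵐ`. -/
def hermiteFunMulti {m : ℕ} (k : Fin m → ℕ) (x : E m) : ℝ :=
  ∏ i, hermiteFun (k i) (x i)

/-- The scaled Hermite function `h_{k,τ}(x) = τ^(m/4) h_k(τ^(1/2) x)`, `τ > 0`. -/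
def scaledHermite {m : ℕ} (k : Fin m → ℕ) (τ : ℝ) (x : E m) : ℝ :=
  τ ^ ((m : ℝ) / 4) * hermiteFunMulti k (Real.sqrt τ • x)

/-! ### The Fourier transform in the second variable -/

/-- The unitary Fourier transform `ℱ''` on `L²(ℝⁿ)` with the normalization
`(2π)^(-n/2) ∫ u(v) e^{-i ξ·v} dv`, as a function defined almost everywhere. Mathlib's `𝓕` is the
`L²`-extension of `∫ u(v) e^{-2πi ξ·v} dv`. -/
def fourierL2 {n : ℕ} (u : Lp (α := E n) ℂ 2 volume) (ξ : E n) : ℂ :=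
  (((2 * Real.pi) ^ (-(n : ℝ) / 2) : ℝ) : ℂ) *
    (𝓕 u : Lp (α := E n) ℂ 2 volume) ((2 * Real.pi)⁻¹ • ξ)

/-- `F(x', ·) = ℱ''(f(x', ·))` for almost every `x'`. Equivalently `f(x', ·) = ℱ''⁻¹(F(x', ·))`. -/
def IsPartialFourier {m n : ℕ} (f F : L2 m n) : Prop :=
  ∀ᵐ x' : E m, ∃ h : MemLp (fun x'' : E n => f (x', x'')) 2 volume,
    (fun ξ : E n => F (x', ξ)) =ᵐ[volume] fourierL2 h.toLp

/-! ### The `𝒢`-transform, its inverse, and the functional calculus -/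

/-- `Φ = 𝒢 f`: for almost every `ξ` and every `k`, `Φ(k, ξ)` is the `k`-th coefficient
`⟨F(·, ξ), h_{k,|ξ|}⟩`, where `F` is the partial Fourier transform of `f`. -/
def IsGTransform {m n : ℕ} (f : L2 m n) (Φ : L2Γ m n) : Prop :=
  ∃ F : L2 m n, IsPartialFourier f F ∧
    ∀ᵐ ξ : E n, ∀ k : Fin m → ℕ,
      Φ (k, ξ) = ∫ x' : E m, F (x', ξ) * (scaledHermite k ‖ξ‖ x' : ℂ)

/-- `g = 𝒢⁻¹ Ψ`: for almost every `ξ` the Hermite series `∑ₖ Ψ(k, ξ) h_{k,|ξ|}` converges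
(unconditionally) in `L²(ℝᵐ)` to `U(·, ξ)`, and `g(x', ·) = ℱ''⁻¹(U(x', ·))` for almost every
`x'`. -/
def IsInvGTransform {m n : ℕ} (Ψ : L2Γ m n) (g : L2 m n) : Prop :=
  ∃ U : L2 m n,
    (∀ᵐ ξ : E n, Tendsto
      (fun s : Finset (Fin m → ℕ) => eLpNorm
        (fun x' : E m => U (x', ξ) - ∑ k ∈ s, Ψ (k, ξ) * (scaledHermite k ‖ξ‖ x' : ℂ)) 2 volume)
      atTop (𝓝 0)) ∧
    IsPartialFourier g U

/-- `Θ(k, ξ) = (2|k| + m) |ξ|`, with `|k| = k₁ + … + kₘ`. -/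
def Θ {m n : ℕ} (p : (Fin m → ℕ) × E n) : ℝ :=
  (2 * ((∑ i, p.1 i : ℕ) : ℝ) + m) * ‖p.2‖

/-- The graph of `φ(𝔾) = 𝒢⁻¹ ∘ M_{φ∘Θ} ∘ 𝒢`: `f` lies in the domain, i.e. `(φ∘Θ) 𝒢f ∈ L²(Γ)`,
and `φ(𝔾) f = g`. -/
def CalculusGraph {m n : ℕ} (φ : ℝ → ℝ) (f g : L2 m n) : Prop :=
  ∃ Φ Ψ : L2Γ m n, IsGTransform f Φ ∧
    (∀ᵐ p ∂(gammaMeasure m n), Ψ p = (φ (Θ p) : ℂ) * Φ p) ∧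
    IsInvGTransform Ψ g

/-- The graph of `exp(-t𝔾)`. -/
def HeatGraph {m n : ℕ} (t : ℝ) (f g : L2 m n) : Prop :=
  CalculusGraph (fun u => Real.exp (-t * u)) f g

/-! ### The heat kernel -/

/-- The hyperbolic cotangent. -/
def coth (u : ℝ) : ℝ := Real.cosh u / Real.sinh u

/-- The integrand of the heat kernel. -/
def heatIntegrand {m n : ℕ} (t : ℝ) (x y : E m × E n) (ξ : E n) : ℂ :=
  Complex.exp (Complex.I * ((1 / t * inner ℝ (x.2 - y.2) ξ : ℝ) : ℂ)) *
    ((Real.exp (-(‖ξ‖ / (4 * t)) *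
        (‖x.1 + y.1‖ ^ 2 * Real.tanh ‖ξ‖ + ‖x.1 - y.1‖ ^ 2 * coth ‖ξ‖)) *
      (‖ξ‖ / Real.sinh (2 * ‖ξ‖)) ^ ((m : ℝ) / 2) : ℝ) : ℂ)

/-- The heat kernel `p_t(x, y)`, with `D = m + 2n`. -/
def heatKernel {m n : ℕ} (t : ℝ) (x y : E m × E n) : ℂ :=
  (((2 * Real.pi * t) ^ (-((m : ℝ) + 2 * n) / 2) : ℝ) : ℂ) *
    ∫ ξ : E n, heatIntegrand t x y ξ

end Grushin

end

/-!
The partial Fourier transform in `x''` decomposes `exp(-t𝔾)` into operators on `L²(ℝᵐ)`: at the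
frequency `ξ`, with `τ = |ξ| > 0`, the fibre is `∑ₖ e^{-t(2|k|+m)τ} ⟨·, h_{k,τ}⟩ h_{k,τ}`. By
Mehler's formula this is the integral operator with the Gaussian kernel `mehlerKernel t τ`.
Inverting the partial Fourier transform and exchanging integrals turns the fibre kernels into a
kernel on `ℝᵈ`, namely the Fourier integral in `ξ` of `mehlerKernel t |ξ|`; the substitution
`ξ ↦ t ξ` identifies it with `p_t` (`heatKernel_eq`).

* **Mehler's formula.** The Hermite polynomial `He_j(x)` is the Gaussian average of `(x + i z)ʲ`
  (`integral_add_I_pow`). Hence `∑ⱼ rʲ/j! He_j(x) He_j(y)` is the Gaussian average of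
  `exp(r (x + i z) (y + i w))` over `(z, w)`, which is computed in closed form (`hasSum_mehler`).
  Rescaling and multiplying over the coordinates gives `hasSum_scaledHermite`.

* **The fibre.** Since `∑ₖ e^{-t(2|k|+m)τ} < ∞`, the Hermite series converges absolutely in `L²`,
  and its sum is the integral operator with the Mehler kernel (`tendsto_eLpNorm_mehlerOp_sub`). Only
  the orthonormality of the Hermite functions enters, through Bessel's inequality; their
  completeness plays no role.

* **Existence.** The partial Fourier transform of an `L²` function exists as a jointly measurable
  function, as the `L²` limit of the transforms of truncations (`exists_partial_fourier`). Bessel's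
  inequality on each fibre bounds the Hermite coefficients and the image in `L²`, so that every `f`
  lies in the domain (`exists_heatGraph`).

* **The kernel formula.** The bounds `mehlerKernel_le` and `kernelFactor_le` show that
  `(y', ξ) ↦ mehlerKernel t |ξ| x' y'` is square-integrable and decays exponentially in `ξ`. So the
  Fourier integral of `p_t(x, y)` converges absolutely, `p_t(x, ·)` is in `L²` by Plancherel
  (`memLp_heatKernel`), and Fourier inversion, Fubini's theorem and the multiplication formula
  `∫ û φ = ∫ u φ̂` on the slices of `f` give the representation for almost every `x`
  (`fourierInv_mehlerOp_eq`, `heatGraph_apply`). This formula determines the image of `f`, which is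
  the uniqueness part of well-definedness.
-/

noncomputable section

namespace Grushin

/-! ### The Fourier transform on `L²` -/

section FourierL2

variable {V : Type*} [NormedAddCommGroup V] [InnerProductSpace ℝ V] [FiniteDimensional ℝ V]
  [MeasurableSpace V] [BorelSpace V]

open SchwartzMap

theorem continuous_integral_mul {α : Type*} [MeasurableSpace α] {μ : Measure α}
    (v : Lp ℂ 2 μ) : Continuous fun w : Lp ℂ 2 μ => ∫ x, w x * v x ∂μ := by
  have h : (fun w : Lp ℂ 2 μ => ∫ x, w x * v x ∂μ) = fun w => inner ℂ (star v) w := by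
    funext w
    rw [L2.inner_def]
    refine integral_congr_ae ?_
    filter_upwards [Lp.coeFn_star v] with x hx
    rw [hx]
    simp
  rw [h]
  fun_prop

/-- The defining property of the Fourier transform of `u` as a tempered distribution. -/
theorem integral_schwartz_mul_fourier (u : Lp (α := V) ℂ 2 volume) (φ : 𝓢(V, ℂ)) :
    ∫ x, φ x * (𝓕 u : Lp (α := V) ℂ 2 volume) x = ∫ x, 𝓕 φ x * u x := by
  have h := congrArg (fun T : 𝓢'(V, ℂ) => T φ) (Lp.fourier_toTemperedDistribution_eq u)
  simp only [TemperedDistribution.fourier_apply, Lp.toTemperedDistribution_apply,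
    smul_eq_mul] at h
  exact h.symm

/-- The Fourier transform on `L²` is symmetric for the bilinear pairing. -/
theorem integral_mul_fourier (w u : Lp (α := V) ℂ 2 volume) :
    ∫ x, w x * (𝓕 u : Lp (α := V) ℂ 2 volume) x =
      ∫ x, (𝓕 w : Lp (α := V) ℂ 2 volume) x * u x := by
  refine DenseRange.induction_on
    (p := fun w : Lp (α := V) ℂ 2 volume =>
      ∫ x, w x * (𝓕 u : Lp (α := V) ℂ 2 volume) x =
        ∫ x, (𝓕 w : Lp (α := V) ℂ 2 volume) x * u x)
    (SchwartzMap.denseRange_toLpCLM (μ := (volume : Measure V)) (p := 2)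
      ENNReal.ofNat_ne_top) w ?_ ?_
  · exact isClosed_eq (continuous_integral_mul _)
      ((continuous_integral_mul u).comp (Lp.fourierTransformₗᵢ V ℂ).continuous)
  · intro φ
    have h1 : ((𝓕 (φ.toLp 2 : Lp (α := V) ℂ 2 volume) : Lp (α := V) ℂ 2 volume)) =ᵐ[volume]
        ⇑(𝓕 φ : 𝓢(V, ℂ)) := by
      rw [SchwartzMap.toLp_fourier_eq]
      exact SchwartzMap.coeFn_toLp _ _ _
    have h2 := SchwartzMap.coeFn_toLp φ 2 (volume : Measure V)
    simp only [SchwartzMap.toLpCLM_apply]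
    calc _ = ∫ x, φ x * (𝓕 u : Lp (α := V) ℂ 2 volume) x :=
          integral_congr_ae (by filter_upwards [h2] with x hx; rw [hx])
      _ = _ := integral_schwartz_mul_fourier u φ
      _ = _ := integral_congr_ae (by filter_upwards [h1] with x hx; rw [hx])

/-- On `L¹ ∩ L²` the `L²` Fourier transform is given by the Fourier integral. -/
theorem coeFn_fourier_toLp {u : V → ℂ} (h1 : Integrable u) (h2 : MemLp u 2) :
    (𝓕 h2.toLp : Lp (α := V) ℂ 2 volume) =ᵐ[volume] 𝓕 u := by
  have hc : Continuous (𝓕 u) :=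
    VectorFourier.fourierIntegral_continuous Real.continuous_fourierChar
      (by exact continuous_inner) h1
  -- Both sides are locally integrable and agree against test functions.
  refine ae_eq_of_integral_contDiff_smul_eq
    ((Lp.memLp _).locallyIntegrable one_le_two)
    hc.locallyIntegrable fun g hg hgc => ?_
  have hgc' : HasCompactSupport (fun x => (g x : ℂ)) := hgc.comp_left (g := Complex.ofReal) rfl
  have hg' : ContDiff ℝ ((⊤ : ℕ∞) : WithTop ℕ∞) (fun x => (g x : ℂ)) :=
    Complex.ofRealCLM.contDiff.comp hg
  let φ : 𝓢(V, ℂ) := hgc'.toSchwartzMap hg'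
  have e1 := integral_schwartz_mul_fourier h2.toLp φ
  have e2 := VectorFourier.integral_fourierIntegral_smul_eq_flip (L := innerₗ V)
    Real.continuous_fourierChar continuous_inner (φ.integrable (μ := volume)) h1
  simp only [Complex.real_smul]
  calc ∫ x, (g x : ℂ) * (𝓕 h2.toLp : Lp (α := V) ℂ 2 volume) x
      = ∫ x, 𝓕 φ x * (h2.toLp : Lp (α := V) ℂ 2 volume) x := e1
    _ = ∫ x, 𝓕 φ x * u x :=
        integral_congr_ae (by filter_upwards [h2.coeFn_toLp] with x hx; rw [hx])
    _ = ∫ x, (g x : ℂ) * 𝓕 u x := by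
        rw [flip_innerₗ] at e2
        exact e2

/-- On `L²` the inverse Fourier transform is the reflected Fourier transform. -/
theorem coeFn_fourierInv (u : Lp (α := V) ℂ 2 volume) :
    (𝓕⁻ u : Lp (α := V) ℂ 2 volume) =ᵐ[volume] fun x => (𝓕 u : Lp (α := V) ℂ 2 volume) (-x) := by
  have hneg := Measure.measurePreserving_neg (volume : Measure V)
  suffices h : 𝓕⁻ u = Lp.compMeasurePreserving (fun x : V => -x) hneg (𝓕 u) by
    rw [h]
    exact Lp.coeFn_compMeasurePreserving _ hneg
  refine DenseRange.induction_on
    (p := fun u : Lp (α := V) ℂ 2 volume =>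
      𝓕⁻ u = Lp.compMeasurePreserving (fun x : V => -x) hneg (𝓕 u))
    (SchwartzMap.denseRange_toLpCLM (μ := (volume : Measure V)) (p := 2)
      ENNReal.ofNat_ne_top) u ?_ ?_
  · exact isClosed_eq (Lp.fourierTransformₗᵢ V ℂ).symm.continuous
      ((Lp.isometry_compMeasurePreserving hneg).continuous.comp
        (Lp.fourierTransformₗᵢ V ℂ).continuous)
  · intro φ
    simp only [SchwartzMap.toLpCLM_apply]
    rw [SchwartzMap.toLp_fourierInv_eq, SchwartzMap.toLp_fourier_eq]
    refine Lp.ext ?_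
    filter_upwards [SchwartzMap.coeFn_toLp (𝓕⁻ φ) 2 (volume : Measure V),
      Lp.coeFn_compMeasurePreserving ((𝓕 φ).toLp 2 (volume : Measure V)) hneg,
      hneg.quasiMeasurePreserving.ae (SchwartzMap.coeFn_toLp (𝓕 φ) 2 (volume : Measure V))]
      with x h1 h2 h3
    rw [h1, h2]
    simp only [Function.comp]
    rw [h3, SchwartzMap.fourierInv_coe, SchwartzMap.fourier_coe, Real.fourierInv_eq_fourier_neg]

end FourierL2

/-! ### Slices of square-integrable functions -/

section Slices

variable {α β : Type*} [MeasurableSpace α] [MeasurableSpace β] {μ : Measure α} {ν : Measure β}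

theorem eLpNorm_two_sq (f : α → ℂ) : eLpNorm f 2 μ ^ 2 = ∫⁻ x, ‖f x‖ₑ ^ 2 ∂μ := by
  have h := eLpNorm_nnreal_pow_eq_lintegral (f := f) (μ := μ) (p := 2) two_ne_zero
  simp only [NNReal.coe_ofNat, ENNReal.coe_ofNat] at h
  simpa only [← ENNReal.rpow_natCast, Nat.cast_ofNat] using h

theorem eLpNorm_two_eq_iff {f : α → ℂ} {g : β → ℂ} :
    eLpNorm f 2 μ = eLpNorm g 2 ν ↔ ∫⁻ x, ‖f x‖ₑ ^ 2 ∂μ = ∫⁻ x, ‖g x‖ₑ ^ 2 ∂ν := by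
  rw [← eLpNorm_two_sq, ← eLpNorm_two_sq]
  exact (ENNReal.pow_right_strictMono two_ne_zero).injective.eq_iff.symm

theorem eLpNorm_two_le_iff {f : α → ℂ} {g : β → ℂ} :
    eLpNorm f 2 μ ≤ eLpNorm g 2 ν ↔ ∫⁻ x, ‖f x‖ₑ ^ 2 ∂μ ≤ ∫⁻ x, ‖g x‖ₑ ^ 2 ∂ν := by
  rw [← eLpNorm_two_sq, ← eLpNorm_two_sq]
  exact (ENNReal.pow_right_strictMono two_ne_zero).le_iff_le.symm

theorem memLp_two_iff_lintegral {f : α → ℂ} (hf : AEStronglyMeasurable f μ) :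
    MemLp f 2 μ ↔ ∫⁻ x, ‖f x‖ₑ ^ 2 ∂μ < ⊤ := by
  rw [← eLpNorm_two_sq]
  refine ⟨fun h => ENNReal.pow_lt_top h.2, fun h => ⟨hf, ?_⟩⟩
  by_contra h'
  rw [not_lt, top_le_iff] at h'
  simp [h'] at h

theorem tendsto_eLpNorm_two_iff {ι : Type*} {l : Filter ι} {f : ι → α → ℂ} :
    Tendsto (fun i => eLpNorm (f i) 2 μ) l (𝓝 0) ↔
      Tendsto (fun i => ∫⁻ x, ‖f i x‖ₑ ^ 2 ∂μ) l (𝓝 0) := by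
  simp only [← eLpNorm_two_sq]
  refine ⟨fun h => ?_, fun h => ?_⟩
  · have h1 := (ENNReal.continuous_pow 2).tendsto 0 |>.comp h
    rwa [zero_pow two_ne_zero] at h1
  · have h1 := ENNReal.continuous_rpow_const (y := 1 / 2) |>.tendsto 0 |>.comp h
    rw [ENNReal.zero_rpow_of_pos (by norm_num)] at h1
    refine h1.congr fun j => ?_
    simp only [Function.comp]
    rw [← ENNReal.rpow_natCast, ← ENNReal.rpow_mul]
    norm_num

theorem lintegral_enorm_sq_prod [SFinite ν] {f : α × β → ℂ}
    (hf : AEStronglyMeasurable f (μ.prod ν)) :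
    ∫⁻ p, ‖f p‖ₑ ^ 2 ∂(μ.prod ν) = ∫⁻ x, ∫⁻ y, ‖f (x, y)‖ₑ ^ 2 ∂ν ∂μ :=
  lintegral_prod _ (hf.enorm.pow_const 2)

/-- Functions on products whose slices have equal `L²` norms have equal `L²` norms. -/
theorem eLpNorm_two_prod_congr [SFinite ν] {γ : Type*} [MeasurableSpace γ] {ρ : Measure γ}
    [SFinite ρ] {f : α × β → ℂ} {g : α × γ → ℂ}
    (hf : AEStronglyMeasurable f (μ.prod ν)) (hg : AEStronglyMeasurable g (μ.prod ρ))
    (h : ∀ᵐ x ∂μ, eLpNorm (fun y => f (x, y)) 2 ν = eLpNorm (fun y => g (x, y)) 2 ρ) :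
    eLpNorm f 2 (μ.prod ν) = eLpNorm g 2 (μ.prod ρ) := by
  rw [eLpNorm_two_eq_iff, lintegral_enorm_sq_prod hf, lintegral_enorm_sq_prod hg]
  refine lintegral_congr_ae ?_
  filter_upwards [h] with x hx
  rwa [eLpNorm_two_eq_iff] at hx

theorem ae_memLp_slice [SFinite ν] {f : α × β → ℂ} (hf : MemLp f 2 (μ.prod ν)) :
    ∀ᵐ x ∂μ, MemLp (fun y => f (x, y)) 2 ν := by
  have h := (memLp_two_iff_lintegral hf.1).1 hf
  rw [lintegral_enorm_sq_prod hf.1] at h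
  filter_upwards [hf.1.prodMk_left,
    ae_lt_top' (hf.1.enorm.pow_const 2).lintegral_prod_right' h.ne] with x h1 h2
  exact (memLp_two_iff_lintegral h1).2 h2

theorem tendsto_eLpNorm_indicator_sub {f : α → ℂ} (hf : MemLp f 2 μ) {s : ℕ → Set α}
    (hs : ∀ j, MeasurableSet (s j)) (hcov : ∀ x, ∀ᶠ j in atTop, x ∈ s j) :
    Tendsto (fun j => eLpNorm ((s j).indicator f - f) 2 μ) atTop (𝓝 0) := by
  have h0 : Tendsto (fun j => ∫⁻ x, ‖((s j).indicator f - f) x‖ₑ ^ 2 ∂μ) atTop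
      (𝓝 (∫⁻ _, 0 ∂μ)) := by
    refine tendsto_lintegral_of_dominated_convergence' (fun x => ‖f x‖ₑ ^ 2) (fun j => ?_)
      (fun j => ae_of_all _ fun x => ?_) ((memLp_two_iff_lintegral hf.1).1 hf).ne
      (ae_of_all _ fun x => ?_)
    · exact ((hf.1.indicator (hs j)).sub hf.1).enorm.pow_const 2
    · by_cases hx : x ∈ s j <;> simp [hx]
    · refine tendsto_const_nhds.congr' ?_
      filter_upwards [hcov x] with j hj
      simp [hj]
  rw [lintegral_zero] at h0
  exact tendsto_eLpNorm_two_iff.2 h0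

theorem exists_subseq_ae_tendsto_zero {h : ℕ → α → ENNReal} (hm : ∀ j, AEMeasurable (h j) μ)
    (hlim : Tendsto (fun j => ∫⁻ x, h j x ∂μ) atTop (𝓝 0)) :
    ∃ ns : ℕ → ℕ, StrictMono ns ∧ ∀ᵐ x ∂μ, Tendsto (fun k => h (ns k) x) atTop (𝓝 0) := by
  obtain ⟨ns, hns, hle⟩ := extraction_forall_of_eventually
    (P := fun k j => ∫⁻ x, h j x ∂μ ≤ (2⁻¹ : ENNReal) ^ k) fun k =>
      hlim.eventually_le_const (ENNReal.pow_pos (by simp) k)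
  refine ⟨ns, hns, ?_⟩
  -- The chosen integrals are summable, so the sum is finite almost everywhere.
  have h1 : ∫⁻ x, ∑' k, h (ns k) x ∂μ ≠ ⊤ := by
    rw [lintegral_tsum fun k => hm _]
    refine ((ENNReal.tsum_le_tsum hle).trans_lt ?_).ne
    simp [ENNReal.tsum_geometric]
  filter_upwards [ae_lt_top' (AEMeasurable.tsum fun k => hm _) h1] with x hx
  exact ENNReal.tendsto_atTop_zero_of_tsum_ne_top hx.ne

/-- `L²` convergence on a product implies, along a subsequence, `L²` convergence of almost every
slice. -/
theorem exists_subseq_ae_tendsto_slice [SFinite ν] {G : ℕ → α × β → ℂ} {F : α × β → ℂ}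
    (hG : ∀ j, StronglyMeasurable (G j)) (hF : StronglyMeasurable F)
    (hlim : Tendsto (fun j => eLpNorm (fun p => G j p - F p) 2 (μ.prod ν)) atTop (𝓝 0)) :
    ∃ ns : ℕ → ℕ, StrictMono ns ∧ ∀ᵐ x ∂μ,
      Tendsto (fun k => eLpNorm (fun y => G (ns k) (x, y) - F (x, y)) 2 ν) atTop (𝓝 0) := by
  have hm : ∀ j, StronglyMeasurable fun p => G j p - F p := fun j => (hG j).sub hF
  rw [tendsto_eLpNorm_two_iff] at hlim
  simp only [lintegral_enorm_sq_prod (hm _).aestronglyMeasurable] at hlim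
  simp only [tendsto_eLpNorm_two_iff]
  exact exists_subseq_ae_tendsto_zero
    (fun j => ((hm j).enorm.pow_const 2).lintegral_prod_right'.aemeasurable) hlim

/-- If `A j ↦ G j` preserves `L²` distances and `A j` converges in `L²`, then so does `G j`. -/
theorem exists_tendsto_of_eLpNorm_sub_eq {A : ℕ → α → ℂ} {G : ℕ → β → ℂ}
    (hA : ∀ j, MemLp (A j) 2 μ) (hG : ∀ j, MemLp (G j) 2 ν)
    (h : ∀ j l, eLpNorm (G j - G l) 2 ν = eLpNorm (A j - A l) 2 μ) {f : α → ℂ}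
    (hf : MemLp f 2 μ) (hlim : Tendsto (fun j => eLpNorm (A j - f) 2 μ) atTop (𝓝 0)) :
    ∃ F : Lp ℂ 2 ν, Tendsto (fun j => eLpNorm (fun y => G j y - F y) 2 ν) atTop (𝓝 0) := by
  have hconv : Tendsto (fun j => (hA j).toLp) atTop (𝓝 hf.toLp) := by
    rw [Lp.tendsto_Lp_iff_tendsto_eLpNorm']
    refine hlim.congr fun j => ?_
    exact eLpNorm_congr_ae ((hA j).coeFn_toLp.symm.sub hf.coeFn_toLp.symm)
  have hcauchy : CauchySeq fun j => (hG j).toLp := by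
    have h' := hconv.cauchySeq
    rw [Metric.cauchySeq_iff] at h' ⊢
    simpa only [Lp.dist_def, eLpNorm_congr_ae ((hG _).coeFn_toLp.sub (hG _).coeFn_toLp),
      eLpNorm_congr_ae ((hA _).coeFn_toLp.sub (hA _).coeFn_toLp), h] using h'
  obtain ⟨F, hF⟩ := cauchySeq_tendsto_of_complete hcauchy
  refine ⟨F, ?_⟩
  rw [Lp.tendsto_Lp_iff_tendsto_eLpNorm'] at hF
  exact hF.congr fun j => eLpNorm_congr_ae ((hG j).coeFn_toLp.sub (ae_eq_refl F))

end Slices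

/-! ### The partial Fourier transform -/

section PartialFourier

variable {α : Type*} [MeasurableSpace α] {ν : Measure α}
variable {V : Type*} [NormedAddCommGroup V] [InnerProductSpace ℝ V] [FiniteDimensional ℝ V]
  [MeasurableSpace V] [BorelSpace V]

theorem eLpNorm_fourier_eq {u : V → ℂ} (h1 : Integrable u) (h2 : MemLp u 2) :
    eLpNorm (𝓕 u) 2 volume = eLpNorm u 2 volume := by
  rw [← eLpNorm_congr_ae (coeFn_fourier_toLp h1 h2), ← eLpNorm_congr_ae h2.coeFn_toLp]
  have h := Lp.norm_fourier_eq (h2.toLp : Lp (α := V) ℂ 2 volume)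
  rw [Lp.norm_def, Lp.norm_def] at h
  exact (ENNReal.toReal_eq_toReal_iff' (Lp.eLpNorm_ne_top _) (Lp.eLpNorm_ne_top _)).1 h

/-- Plancherel for the difference of a Fourier integral and an `L²` Fourier transform. -/
theorem eLpNorm_fourier_sub_eq {w u : V → ℂ} (h1 : Integrable w) (h2 : MemLp w 2)
    (hu : MemLp u 2) :
    eLpNorm (fun ξ => 𝓕 w ξ - (𝓕 hu.toLp : Lp (α := V) ℂ 2 volume) ξ) 2 volume =
      eLpNorm (w - u) 2 volume := by
  have e := Lp.norm_fourier_eq (h2.toLp - hu.toLp : Lp (α := V) ℂ 2 volume)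
  have hs : (𝓕 (h2.toLp - hu.toLp : Lp (α := V) ℂ 2 volume) : Lp (α := V) ℂ 2 volume) =
      𝓕 h2.toLp - 𝓕 hu.toLp := (Lp.fourierTransformₗᵢ V ℂ).map_sub _ _
  rw [hs, Lp.norm_def, Lp.norm_def] at e
  have e' := (ENNReal.toReal_eq_toReal_iff' (Lp.eLpNorm_ne_top _) (Lp.eLpNorm_ne_top _)).1 e
  rw [eLpNorm_congr_ae (Lp.coeFn_sub _ _), eLpNorm_congr_ae (Lp.coeFn_sub _ _),
    eLpNorm_congr_ae (h2.coeFn_toLp.sub hu.coeFn_toLp)] at e'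
  rw [← e']
  exact eLpNorm_congr_ae ((coeFn_fourier_toLp h1 h2).symm.sub (ae_eq_refl _))

theorem stronglyMeasurable_fourier_slice {f : α × V → ℂ} (hf : StronglyMeasurable f) :
    StronglyMeasurable fun p : α × V => 𝓕 (fun v => f (p.1, v)) p.2 := by
  simp only [Real.fourier_eq]
  refine StronglyMeasurable.integral_prod_right'
    (f := fun q : (α × V) × V => Real.fourierChar (-inner ℝ q.2 q.1.2) • f (q.1.1, q.2)) ?_
  refine StronglyMeasurable.smul (𝕜 := Circle) ?_ ?_
  · refine Continuous.comp_stronglyMeasurable Real.continuous_fourierChar ?_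
    exact (StronglyMeasurable.inner measurable_snd.stronglyMeasurable
      (measurable_snd.comp measurable_fst).stronglyMeasurable).neg
  · exact hf.comp_measurable (by fun_prop)

/-- The partial Fourier transform exists as a jointly measurable square-integrable function. It is
the `L²` limit of the partial Fourier integrals of the truncations of `f` to `‖v‖ ≤ j`; by
Plancherel on slices these converge, and along a subsequence almost every slice converges to the
transform of the slice of `f`. -/
theorem exists_partial_fourier (f : Lp (α := α × V) ℂ 2 (ν.prod volume)) :
    ∃ F : Lp (α := α × V) ℂ 2 (ν.prod volume), ∀ᵐ x ∂ν,
      ∃ h : MemLp (fun v : V => f (x, v)) 2 volume,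
        (fun ξ : V => F (x, ξ)) =ᵐ[volume] (𝓕 h.toLp : Lp (α := V) ℂ 2 volume) := by
  have hfm := Lp.stronglyMeasurable f
  have hf2 : MemLp f 2 (ν.prod volume) := Lp.memLp f
  set s : ℕ → Set (α × V) := fun j => {p | ‖p.2‖ ≤ j}
  have hs : ∀ j, MeasurableSet (s j) := fun j =>
    measurableSet_le measurable_snd.norm measurable_const
  have hs' : ∀ j : ℕ, MeasurableSet {v : V | ‖v‖ ≤ j} := fun j =>
    measurableSet_le measurable_norm measurable_const
  have hcov' : ∀ v : V, ∀ᶠ j : ℕ in atTop, ‖v‖ ≤ j := fun v =>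
    (tendsto_natCast_atTop_atTop (R := ℝ)).eventually_ge_atTop ‖v‖
  have hslice : ∀ (j : ℕ) x, (fun v => (s j).indicator f (x, v)) =
      {v : V | ‖v‖ ≤ j}.indicator (fun v => f (x, v)) := by
    intro j x
    ext v
    by_cases hv : ‖v‖ ≤ j
    · rw [Set.indicator_of_mem (show (x, v) ∈ s j from hv),
        Set.indicator_of_mem (show v ∈ {v : V | ‖v‖ ≤ j} from hv)]
    · rw [Set.indicator_of_notMem (show (x, v) ∉ s j from hv),
        Set.indicator_of_notMem (show v ∉ {v : V | ‖v‖ ≤ j} from hv)]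
  have hA2 : ∀ j, MemLp ((s j).indicator f) 2 (ν.prod volume) := fun j => hf2.indicator (hs j)
  set G : ℕ → α × V → ℂ := fun j p => 𝓕 (fun v => (s j).indicator f (p.1, v)) p.2
  have hGs : ∀ j x, (fun ξ => G j (x, ξ)) = 𝓕 fun v => (s j).indicator f (x, v) :=
    fun _ _ => rfl
  have hGm : ∀ j, StronglyMeasurable (G j) := fun j =>
    stronglyMeasurable_fourier_slice (hfm.indicator (hs j))
  have hgood : ∀ᵐ x ∂ν, MemLp (fun v => f (x, v)) 2 volume := ae_memLp_slice hf2
  have hL2 : ∀ x, MemLp (fun v => f (x, v)) 2 volume → ∀ j,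
      MemLp (fun v => (s j).indicator f (x, v)) 2 volume := fun x hx j => by
    rw [hslice]; exact hx.indicator (hs' j)
  have hL1 : ∀ x, MemLp (fun v => f (x, v)) 2 volume → ∀ j,
      Integrable (fun v => (s j).indicator f (x, v)) volume := fun x hx j => by
    rw [hslice, integrable_indicator_iff (hs' j)]
    have hb : {v : V | ‖v‖ ≤ j} = Metric.closedBall 0 j := by ext v; simp
    have : IsFiniteMeasure (volume.restrict {v : V | ‖v‖ ≤ j}) := by
      rw [hb]
      exact ⟨by simpa using measure_closedBall_lt_top⟩
    exact (hx.restrict _).integrable one_le_two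
  have hdiff : ∀ j l, eLpNorm (G j - G l) 2 (ν.prod volume) =
      eLpNorm ((s j).indicator f - (s l).indicator f) 2 (ν.prod volume) := by
    intro j l
    refine eLpNorm_two_prod_congr ((hGm j).sub (hGm l)).aestronglyMeasurable
      ((hA2 j).sub (hA2 l)).1 ?_
    filter_upwards [hgood] with x hx
    have h := eLpNorm_fourier_eq ((hL1 x hx j).sub (hL1 x hx l)) ((hL2 x hx j).sub (hL2 x hx l))
    refine Eq.trans ?_ h
    congr 1
    ext ξ
    simp only [G, Pi.sub_apply, Real.fourier_eq]
    rw [← integral_sub]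
    · simp only [smul_sub]
    · exact (Real.fourierIntegral_convergent_iff ξ).2 (hL1 x hx j)
    · exact (Real.fourierIntegral_convergent_iff ξ).2 (hL1 x hx l)
  have hG2 : ∀ j, MemLp (G j) 2 (ν.prod volume) := fun j => by
    refine ⟨(hGm j).aestronglyMeasurable, ?_⟩
    rw [eLpNorm_two_prod_congr (hGm j).aestronglyMeasurable (hA2 j).1]
    · exact (hA2 j).2
    · filter_upwards [hgood] with x hx
      rw [hGs, eLpNorm_fourier_eq (hL1 x hx j) (hL2 x hx j)]
  obtain ⟨F, hF⟩ := exists_tendsto_of_eLpNorm_sub_eq hA2 hG2 hdiff hf2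
    (tendsto_eLpNorm_indicator_sub hf2 hs fun p => hcov' p.2)
  refine ⟨F, ?_⟩
  obtain ⟨ns, hns, hlim⟩ := exists_subseq_ae_tendsto_slice hGm (Lp.stronglyMeasurable F) hF
  filter_upwards [hgood, hlim, ae_memLp_slice (Lp.memLp F)] with x hx hF' hxF
  refine ⟨hx, ?_⟩
  set u : Lp (α := V) ℂ 2 volume := 𝓕 (hx.toLp : Lp (α := V) ℂ 2 volume)
  have hu : Tendsto (fun k => eLpNorm (fun ξ => G (ns k) (x, ξ) - u ξ) 2 volume) atTop (𝓝 0) := by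
    have h := (tendsto_eLpNorm_indicator_sub hx hs' hcov').comp hns.tendsto_atTop
    refine h.congr fun k => ?_
    simp only [Function.comp]
    rw [← hslice]
    exact (eLpNorm_fourier_sub_eq (hL1 x hx (ns k)) (hL2 x hx (ns k)) hx).symm
  have hzero : eLpNorm (fun ξ => F (x, ξ) - u ξ) 2 volume = 0 := by
    refine le_antisymm (ge_of_tendsto' (b := eLpNorm (fun ξ => F (x, ξ) - u ξ) 2 volume)
      (by simpa using hF'.add hu) fun k => ?_) zero_le
    have hGk : AEStronglyMeasurable (fun ξ => G (ns k) (x, ξ)) volume :=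
      ((hGm (ns k)).comp_measurable measurable_prodMk_left).aestronglyMeasurable
    have e : (fun ξ => F (x, ξ) - u ξ) =
        (fun ξ => G (ns k) (x, ξ) - u ξ) - (fun ξ => G (ns k) (x, ξ) - F (x, ξ)) := by
      ext ξ; simp
    rw [e, add_comm]
    exact eLpNorm_sub_le (hGk.sub (Lp.aestronglyMeasurable u)) (hGk.sub hxF.1) one_le_two
  filter_upwards [(eLpNorm_eq_zero_iff (hxF.1.sub (Lp.aestronglyMeasurable u)) two_ne_zero).1 hzero]
    with ξ hξ
  exact sub_eq_zero.1 hξ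

end PartialFourier

/-! ### The unitary normalization -/

section Unitary

variable {m n : ℕ}

/-- The constant `(2π)^(-n/2)` of the unitary Fourier transform. -/
def unitaryConst (n : ℕ) : ℝ := (2 * Real.pi) ^ (-(n : ℝ) / 2)

theorem unitaryConst_pos : 0 < unitaryConst n := Real.rpow_pos_of_pos (by positivity) _

theorem unitaryConst_sq : unitaryConst n * unitaryConst n * (2 * Real.pi) ^ n = 1 := by
  rw [unitaryConst, ← Real.rpow_add (by positivity), ← Real.rpow_natCast,
    ← Real.rpow_add (by positivity)]
  ring_nf
  simp

theorem fourierL2_eq (u : Lp (α := E n) ℂ 2 volume) (ξ : E n) :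
    fourierL2 u ξ = (unitaryConst n : ℂ) *
      (𝓕 u : Lp (α := E n) ℂ 2 volume) ((2 * Real.pi)⁻¹ • ξ) := rfl

theorem quasiMeasurePreserving_smul {a : ℝ} (ha : a ≠ 0) :
    Measure.QuasiMeasurePreserving (fun x : E n => a • x) volume volume := by
  refine ⟨measurable_const_smul a, ?_⟩
  have h := Measure.map_addHaar_smul (volume : Measure (E n)) ha
  change Measure.map (fun x : E n => a • x) volume ≪ volume
  rw [h]
  exact Measure.smul_absolutelyContinuous

theorem lintegral_comp_smul {a : ℝ} (ha : a ≠ 0) {f : E n → ENNReal} (hf : AEMeasurable f) :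
    ∫⁻ x, f (a • x) = ENNReal.ofReal |(a ^ n)⁻¹| * ∫⁻ x, f x := by
  have h := Measure.map_addHaar_smul (volume : Measure (E n)) ha
  rw [finrank_euclideanSpace_fin] at h
  have h' : AEMeasurable f (Measure.map (fun x : E n => a • x) volume) :=
    hf.mono_ac (quasiMeasurePreserving_smul ha).absolutelyContinuous
  rw [← lintegral_map' h' (measurable_const_smul a).aemeasurable]
  change ∫⁻ y, f y ∂(Measure.map (a • · ) volume) = _
  rw [h, lintegral_smul_measure, smul_eq_mul]

theorem aestronglyMeasurable_fourierL2 (u : Lp (α := E n) ℂ 2 volume) :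
    AEStronglyMeasurable (fourierL2 u) volume :=
  ((Lp.aestronglyMeasurable _).comp_quasiMeasurePreserving
    (quasiMeasurePreserving_smul (by positivity))).const_mul _

/-- **Plancherel's theorem** for the unitary Fourier transform. -/
theorem lintegral_fourierL2 (u : Lp (α := E n) ℂ 2 volume) :
    ∫⁻ ξ, ‖fourierL2 u ξ‖ₑ ^ 2 = ∫⁻ v, ‖u v‖ₑ ^ 2 := by
  have h := Lp.norm_fourier_eq u
  rw [Lp.norm_def, Lp.norm_def,
    ENNReal.toReal_eq_toReal_iff' (Lp.eLpNorm_ne_top _) (Lp.eLpNorm_ne_top _),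
    eLpNorm_two_eq_iff] at h
  rw [← h]
  simp only [fourierL2_eq, enorm_mul, mul_pow]
  have hm : AEMeasurable fun ξ : E n =>
      ‖(𝓕 u : Lp (α := E n) ℂ 2 volume) ((2 * Real.pi)⁻¹ • ξ)‖ₑ ^ 2 :=
    (((Lp.aestronglyMeasurable _).comp_quasiMeasurePreserving
      (quasiMeasurePreserving_smul (by positivity))).enorm.pow_const 2)
  rw [lintegral_const_mul'' _ hm, lintegral_comp_smul
    (f := fun η => ‖(𝓕 u : Lp (α := E n) ℂ 2 volume) η‖ₑ ^ 2) (by positivity)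
      ((Lp.aestronglyMeasurable _).enorm.pow_const 2), ← mul_assoc]
  have e : ‖(unitaryConst n : ℂ)‖ₑ ^ 2 * ENNReal.ofReal |((2 * Real.pi)⁻¹ ^ n)⁻¹| = 1 := by
    rw [← ofReal_norm, Complex.norm_real, Real.norm_of_nonneg unitaryConst_pos.le,
      ← ENNReal.ofReal_pow unitaryConst_pos.le, ← ENNReal.ofReal_mul (by positivity), inv_pow,
      inv_inv, abs_of_pos (by positivity), sq, unitaryConst_sq, ENNReal.ofReal_one]
  rw [e, one_mul]

/-- Passage from the frequency convention of `𝓕` to the angular one. -/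
theorem fourier_comp_two_pi (w : E n → ℂ) (v : E n) :
    𝓕 (fun η : E n => w ((2 * Real.pi) • η)) v =
      (((2 * Real.pi) ^ n)⁻¹ : ℝ) * ∫ ξ, Complex.exp (-Complex.I * (inner ℝ v ξ : ℝ)) * w ξ := by
  have h := Measure.integral_comp_smul (volume : Measure (E n))
    (fun ξ => Complex.exp (-Complex.I * (inner ℝ v ξ : ℝ)) * w ξ) (2 * Real.pi)
  rw [finrank_euclideanSpace_fin, abs_of_pos (by positivity), Complex.real_smul] at h
  rw [← h, Real.fourier_eq']
  refine integral_congr_ae (ae_of_all _ fun η => ?_)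
  simp only [smul_eq_mul, inner_smul_right, real_inner_comm η v]
  congr 2
  push_cast
  ring

/-- On `L¹ ∩ L²` the unitary Fourier transform is given by the usual integral. -/
theorem fourierL2_toLp {w : E n → ℂ} (h1 : Integrable w) (h2 : MemLp w 2) :
    fourierL2 h2.toLp =ᵐ[volume] fun v =>
      (unitaryConst n : ℂ) * ∫ ξ, Complex.exp (-Complex.I * (inner ℝ v ξ : ℝ)) * w ξ := by
  filter_upwards [(quasiMeasurePreserving_smul (n := n) (a := (2 * Real.pi)⁻¹) (by positivity)).ae
    (coeFn_fourier_toLp h1 h2)] with v hv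
  rw [fourierL2_eq, hv, Real.fourier_eq']
  congr 1
  refine integral_congr_ae (ae_of_all _ fun η => ?_)
  simp only [smul_eq_mul, inner_smul_right, real_inner_comm η v]
  congr 2
  push_cast
  field_simp

/-- The multiplication formula `∫ û φ = ∫ u φ̂`. -/
theorem integral_fourierL2_mul (u : Lp (α := E n) ℂ 2 volume) {φ : E n → ℂ}
    (h1 : Integrable φ) (h2 : MemLp φ 2) :
    ∫ ξ, fourierL2 u ξ * φ ξ = ∫ v, u v * ((unitaryConst n : ℂ) *
      ∫ ξ, Complex.exp (-Complex.I * (inner ℝ v ξ : ℝ)) * φ ξ) := by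
  have hpi : (2 * Real.pi) ≠ 0 := by positivity
  set ψ : E n → ℂ := fun η => φ ((2 * Real.pi) • η)
  have hψ1 : Integrable ψ := h1.comp_smul hpi
  have hψ2 : MemLp ψ 2 := by
    have hm : AEStronglyMeasurable ψ volume :=
      h2.1.comp_quasiMeasurePreserving (quasiMeasurePreserving_smul hpi)
    rw [memLp_two_iff_lintegral hm]
    simp only [ψ]
    rw [lintegral_comp_smul (f := fun η => ‖φ η‖ₑ ^ 2) hpi (h2.1.enorm.pow_const 2)]
    exact ENNReal.mul_lt_top ENNReal.ofReal_lt_top ((memLp_two_iff_lintegral h2.1).1 h2)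
  have key := integral_mul_fourier hψ2.toLp u
  have h := Measure.integral_comp_smul (volume : Measure (E n))
    (fun ξ => fourierL2 u ξ * φ ξ) (2 * Real.pi)
  rw [finrank_euclideanSpace_fin, abs_of_pos (by positivity), Complex.real_smul] at h
  have h' : ∫ ξ, fourierL2 u ξ * φ ξ = ((2 * Real.pi) ^ n : ℝ) * ((unitaryConst n : ℂ) *
      ∫ x, (hψ2.toLp : Lp (α := E n) ℂ 2 volume) x * (𝓕 u : Lp (α := E n) ℂ 2 volume) x) := by
    rw [← integral_const_mul]
    have e : ∫ x, fourierL2 u ((2 * Real.pi) • x) * φ ((2 * Real.pi) • x) =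
        ∫ x, (unitaryConst n : ℂ) * ((hψ2.toLp : Lp (α := E n) ℂ 2 volume) x *
          (𝓕 u : Lp (α := E n) ℂ 2 volume) x) := by
      refine integral_congr_ae ?_
      filter_upwards [hψ2.coeFn_toLp] with x hx
      rw [hx, fourierL2_eq, inv_smul_smul₀ hpi]
      ring
    rw [← e, h, ← mul_assoc, ← Complex.ofReal_mul, mul_inv_cancel₀ (by positivity)]
    simp
  rw [h', key, ← integral_const_mul, ← integral_const_mul]
  refine integral_congr_ae ?_
  filter_upwards [coeFn_fourier_toLp hψ1 hψ2] with v hv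
  rw [hv, fourier_comp_two_pi]
  push_cast
  field_simp

/-- Fourier inversion: if `û` is integrable, then `u` is given by the inversion integral. -/
theorem ae_eq_of_fourierL2_eq {u : Lp (α := E n) ℂ 2 volume} {w : E n → ℂ}
    (h : w =ᵐ[volume] fourierL2 u) (hw : Integrable w) :
    u =ᵐ[volume] fun v =>
      (unitaryConst n : ℂ) * ∫ ξ, Complex.exp (Complex.I * (inner ℝ v ξ : ℝ)) * w ξ := by
  have hpi : (2 * Real.pi) ≠ 0 := by positivity
  have hc : (unitaryConst n : ℂ) ≠ 0 := by exact_mod_cast unitaryConst_pos.ne'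
  set W : E n → ℂ := fun η => (unitaryConst n : ℂ)⁻¹ * w ((2 * Real.pi) • η)
  have hW1 : Integrable W := (hw.comp_smul hpi).const_mul _
  have hW : W =ᵐ[volume] (𝓕 u : Lp (α := E n) ℂ 2 volume) := by
    filter_upwards [(quasiMeasurePreserving_smul hpi).ae h] with η hη
    simp only [W, hη, fourierL2_eq, inv_smul_smul₀ hpi]
    field_simp
  have hW2 : MemLp W 2 := (memLp_congr_ae hW).2 (Lp.memLp _)
  have e : (hW2.toLp : Lp (α := E n) ℂ 2 volume) = 𝓕 u := Lp.ext (hW2.coeFn_toLp.trans hW)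
  have e1 : u = 𝓕⁻ (hW2.toLp : Lp (α := E n) ℂ 2 volume) := by
    rw [e, FourierTransform.fourierInv_fourier_eq]
  rw [e1]
  filter_upwards [coeFn_fourierInv hW2.toLp,
    (quasiMeasurePreserving_smul (n := n) (a := -1) (by norm_num)).ae
      (coeFn_fourier_toLp hW1 hW2)] with v h1 h2
  rw [h1]
  rw [neg_one_smul] at h2
  rw [h2]
  have e2 : 𝓕 W (-v) =
      (unitaryConst n : ℂ)⁻¹ * 𝓕 (fun η : E n => w ((2 * Real.pi) • η)) (-v) := by
    rw [Real.fourier_eq', Real.fourier_eq', ← integral_const_mul]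
    refine integral_congr_ae (ae_of_all _ fun η => ?_)
    simp only [W, smul_eq_mul]
    ring
  rw [e2, fourier_comp_two_pi, ← mul_assoc]
  have e3 : (unitaryConst n : ℂ)⁻¹ * (((2 * Real.pi) ^ n)⁻¹ : ℝ) = unitaryConst n := by
    have := unitaryConst_sq (n := n)
    rw [← Complex.ofReal_inv, ← Complex.ofReal_mul]
    congr 1
    have := unitaryConst_pos (n := n)
    field_simp
    linarith
  rw [e3]
  simp

theorem memLp_comp_smul_snd (b : ℂ) {a : ℝ} (ha : a ≠ 0) {f : E m × E n → ℂ}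
    (hf : StronglyMeasurable f) (hf2 : MemLp f 2 (volume.prod volume)) :
    MemLp (fun p : E m × E n => b * f (p.1, a • p.2)) 2 (volume.prod volume) := by
  have hm : Measurable (fun p : E m × E n => (p.1, a • p.2)) := by fun_prop
  have hsm : StronglyMeasurable fun p : E m × E n => b * f (p.1, a • p.2) :=
    (hf.comp_measurable hm).const_mul b
  rw [memLp_two_iff_lintegral hsm.aestronglyMeasurable,
    lintegral_enorm_sq_prod hsm.aestronglyMeasurable]
  rw [memLp_two_iff_lintegral hf.aestronglyMeasurable,
    lintegral_enorm_sq_prod hf.aestronglyMeasurable] at hf2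
  have hfx : ∀ x : E m, Measurable fun v : E n => ‖f (x, v)‖ₑ ^ 2 := fun x =>
    (hf.comp_measurable measurable_prodMk_left).enorm.pow_const 2
  simp only [enorm_mul, mul_pow]
  have e : ∀ x : E m, ∫⁻ v : E n, ‖b‖ₑ ^ 2 * ‖f (x, a • v)‖ₑ ^ 2 =
      (‖b‖ₑ ^ 2 * ENNReal.ofReal |(a ^ n)⁻¹|) * ∫⁻ v : E n, ‖f (x, v)‖ₑ ^ 2 := by
    intro x
    have hfa : Measurable fun v : E n => ‖f (x, a • v)‖ₑ ^ 2 :=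
      (hfx x).comp (measurable_const_smul a)
    rw [lintegral_const_mul _ hfa,
      lintegral_comp_smul (f := fun v => ‖f (x, v)‖ₑ ^ 2) ha (hfx x).aemeasurable, mul_assoc]
  simp only [e]
  rw [lintegral_const_mul _ (hf.enorm.pow_const 2).lintegral_prod_right']
  exact ENNReal.mul_lt_top (ENNReal.mul_lt_top (by simp) ENNReal.ofReal_lt_top) hf2

/-- Rescaling in the second variable maps `L²` to itself. -/
theorem exists_comp_smul_snd (b : ℂ) {a : ℝ} (ha : a ≠ 0) (f : L2 m n) :
    ∃ g : L2 m n, ∀ᵐ x : E m, (fun v : E n => g (x, v)) =ᵐ[volume] fun v => b * f (x, a • v) :=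
  ⟨(memLp_comp_smul_snd b ha (Lp.stronglyMeasurable f) (Lp.memLp f)).toLp,
    Measure.ae_ae_of_ae_prod (MemLp.coeFn_toLp _)⟩

theorem exists_isPartialFourier (f : L2 m n) : ∃ F : L2 m n, IsPartialFourier f F := by
  obtain ⟨F₀, hF₀⟩ := exists_partial_fourier (ν := (volume : Measure (E m))) (V := E n) f
  obtain ⟨F, hF⟩ := exists_comp_smul_snd (unitaryConst n : ℂ) (a := (2 * Real.pi)⁻¹)
    (by positivity) F₀
  refine ⟨F, ?_⟩
  filter_upwards [hF, hF₀] with x h1 ⟨h, h2⟩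
  refine ⟨h, h1.trans ?_⟩
  filter_upwards [(quasiMeasurePreserving_smul (n := n) (a := (2 * Real.pi)⁻¹) (by positivity)).ae
    h2] with ξ hξ
  rw [hξ, fourierL2_eq]

/-- Surjectivity of the partial Fourier transform. A preimage comes from `𝓕⁻ u = (𝓕 u)(-·)`, so that
the existence of partial Fourier transforms suffices. -/
theorem exists_isPartialFourier_right (U : L2 m n) : ∃ g : L2 m n, IsPartialFourier g U := by
  have hpi : (2 * Real.pi) ≠ 0 := by positivity
  have hc : (unitaryConst n : ℂ) ≠ 0 := by exact_mod_cast unitaryConst_pos.ne'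
  obtain ⟨U₁, hU₁⟩ := exists_comp_smul_snd (unitaryConst n : ℂ)⁻¹ hpi U
  obtain ⟨G, hG⟩ := exists_partial_fourier (ν := (volume : Measure (E m))) (V := E n) U₁
  obtain ⟨g, hg⟩ := exists_comp_smul_snd 1 (a := -1) (by norm_num) G
  refine ⟨g, ?_⟩
  filter_upwards [hU₁, hG, hg] with x h1 ⟨h, h2⟩ h3
  have e : (fun v => g (x, v)) =ᵐ[volume] (𝓕⁻ h.toLp : Lp (α := E n) ℂ 2 volume) := by
    filter_upwards [h3, coeFn_fourierInv h.toLp,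
      (quasiMeasurePreserving_smul (n := n) (a := -1) (by norm_num)).ae h2] with v h4 h5 h6
    rw [h4, h5, h6, one_mul, neg_one_smul]
  have hmem : MemLp (fun v => g (x, v)) 2 volume := (memLp_congr_ae e).2 (Lp.memLp _)
  refine ⟨hmem, ?_⟩
  have e' : 𝓕 (hmem.toLp : Lp (α := E n) ℂ 2 volume) = h.toLp := by
    rw [show (hmem.toLp : Lp (α := E n) ℂ 2 volume) = 𝓕⁻ h.toLp from
      Lp.ext (hmem.coeFn_toLp.trans e), FourierTransform.fourier_fourierInv_eq]
  have hq := quasiMeasurePreserving_smul (n := n) (a := (2 * Real.pi)⁻¹) (by positivity)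
  filter_upwards [hq.ae h1, hq.ae h.coeFn_toLp] with ξ h7 h8
  rw [fourierL2_eq, e', h8, h7, smul_inv_smul₀ hpi]
  field_simp

end Unitary

/-! ### Hermite polynomials -/

section HermitePoly

open Polynomial

/-- The (probabilists') Hermite polynomial as a real function. -/
def hermiteEval (j : ℕ) (x : ℝ) : ℝ := aeval x (hermite j)

theorem derivative_hermite_succ (j : ℕ) :
    derivative (hermite (j + 1)) = ((j + 1 : ℕ) : ℤ[X]) * hermite j := by
  induction j with
  | zero => simp [hermite_succ]
  | succ j ih =>
    have h := hermite_succ (j + 1)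
    have h0 := hermite_succ j
    rw [h, derivative_sub, derivative_mul, derivative_X, one_mul, ih, derivative_mul,
      derivative_natCast, zero_mul, zero_add]
    have e : ((j + 1 : ℕ) : ℤ[X]) * derivative (hermite j) =
        ((j + 1 : ℕ) : ℤ[X]) * (X * hermite j - hermite (j + 1)) := by rw [h0]; ring
    rw [e]
    push_cast
    ring

theorem hermiteEval_zero (x : ℝ) : hermiteEval 0 x = 1 := by simp [hermiteEval]

theorem hermiteEval_one (x : ℝ) : hermiteEval 1 x = x := by simp [hermiteEval]

theorem hermiteEval_succ_succ (j : ℕ) (x : ℝ) :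
    hermiteEval (j + 2) x = x * hermiteEval (j + 1) x - (j + 1) * hermiteEval j x := by
  simp only [hermiteEval]
  rw [hermite_succ (j + 1), derivative_hermite_succ]
  simp

theorem hasDerivAt_hermiteEval_succ (j : ℕ) (x : ℝ) :
    HasDerivAt (hermiteEval (j + 1)) ((j + 1) * hermiteEval j x) x := by
  have h := (hermite (j + 1)).hasDerivAt_aeval x
  rw [derivative_hermite_succ] at h
  refine h.congr_deriv ?_
  simp [hermiteEval]

theorem hasDerivAt_hermiteEval (j : ℕ) (x : ℝ) :
    HasDerivAt (hermiteEval j) (x * hermiteEval j x - hermiteEval (j + 1) x) x := by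
  have h := (hermite j).hasDerivAt_aeval x
  have e : derivative (hermite j) = X * hermite j - hermite (j + 1) := by
    rw [hermite_succ]; ring
  rw [e] at h
  refine h.congr_deriv ?_
  simp only [hermiteEval, map_sub, map_mul, aeval_X]

theorem continuous_hermiteEval (j : ℕ) : Continuous (hermiteEval j) :=
  continuous_iff_continuousAt.2 fun x => (hasDerivAt_hermiteEval j x).continuousAt

/-- The Gaussian weight `exp(-x²/2)`. -/
def gaussWeight (x : ℝ) : ℝ := Real.exp (-x ^ 2 / 2)

theorem hasDerivAt_gaussWeight (x : ℝ) : HasDerivAt gaussWeight (-x * gaussWeight x) x := by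
  have h : HasDerivAt (fun x : ℝ => -x ^ 2 / 2) (-x) x := by
    refine (((hasDerivAt_pow 2 x).neg).div_const 2).congr_deriv ?_
    simp
    ring
  have := h.exp
  rw [mul_comm] at this
  exact this

theorem continuous_gaussWeight : Continuous gaussWeight := by unfold gaussWeight; fun_prop

theorem integral_gaussWeight : ∫ x, gaussWeight x = Real.sqrt (2 * Real.pi) := by
  have h := integral_gaussian (1 / 2)
  rw [show Real.pi / (1 / 2) = 2 * Real.pi by ring] at h
  rw [← h]
  refine integral_congr_ae (ae_of_all _ fun x => ?_)
  simp only [gaussWeight]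
  congr 1
  ring

theorem integrable_pow_mul_gaussWeight (k : ℕ) : Integrable fun x : ℝ => x ^ k * gaussWeight x := by
  have h := integrable_rpow_mul_exp_neg_mul_sq (b := 1 / 2) (by norm_num) (s := k)
    (by linarith [(Nat.cast_nonneg k : (0 : ℝ) ≤ k)])
  refine h.congr (ae_of_all _ fun x => ?_)
  simp only [gaussWeight, Real.rpow_natCast]
  congr 2
  ring

theorem integrable_aeval_mul_gaussWeight (p : ℤ[X]) :
    Integrable fun x : ℝ => aeval x p * gaussWeight x := by
  have e : (fun x : ℝ => aeval x p * gaussWeight x) = fun x =>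
      ∑ i ∈ Finset.range (p.natDegree + 1), (p.coeff i : ℝ) * (x ^ i * gaussWeight x) := by
    funext x
    rw [aeval_eq_sum_range, Finset.sum_mul]
    refine Finset.sum_congr rfl fun i _ => ?_
    simp [mul_assoc]
  rw [e]
  exact integrable_finsetSum _ fun i _ => (integrable_pow_mul_gaussWeight i).const_mul _

theorem integrable_hermiteEval_mul (i j : ℕ) :
    Integrable fun x : ℝ => hermiteEval i x * hermiteEval j x * gaussWeight x := by
  have h := integrable_aeval_mul_gaussWeight (hermite i * hermite j)
  simpa [hermiteEval] using h

/-- Integration by parts, using `He_{i+1} e^{-x²/2} = -(He_i e^{-x²/2})'` and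
`He_{j+1}' = (j + 1) He_j`. -/
theorem integral_hermiteEval_succ_mul_succ (i j : ℕ) :
    ∫ x, hermiteEval (i + 1) x * hermiteEval (j + 1) x * gaussWeight x =
      (j + 1) * ∫ x, hermiteEval i x * hermiteEval j x * gaussWeight x := by
  have hd : ∀ x, HasDerivAt (fun x => hermiteEval i x * hermiteEval (j + 1) x * gaussWeight x)
      ((j + 1) * (hermiteEval i x * hermiteEval j x * gaussWeight x) -
        hermiteEval (i + 1) x * hermiteEval (j + 1) x * gaussWeight x) x := by
    intro x
    refine (((hasDerivAt_hermiteEval i x).mul (hasDerivAt_hermiteEval_succ j x)).mul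
      (hasDerivAt_gaussWeight x)).congr_deriv ?_
    simp only [Pi.mul_apply]
    ring
  have h := integral_eq_zero_of_hasDerivAt_of_integrable hd
    (((integrable_hermiteEval_mul i j).const_mul _).sub (integrable_hermiteEval_mul _ _))
    (integrable_hermiteEval_mul _ _)
  rw [integral_sub ((integrable_hermiteEval_mul i j).const_mul _) (integrable_hermiteEval_mul _ _),
    integral_const_mul] at h
  linarith

theorem integral_hermiteEval_succ (i : ℕ) :
    ∫ x, hermiteEval (i + 1) x * gaussWeight x = 0 := by
  have hi : ∀ i, Integrable fun x => hermiteEval i x * gaussWeight x := fun i => by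
    simpa [hermiteEval_zero] using integrable_hermiteEval_mul i 0
  have hd : ∀ x, HasDerivAt (fun x => hermiteEval i x * gaussWeight x)
      (-(hermiteEval (i + 1) x * gaussWeight x)) x := by
    intro x
    refine ((hasDerivAt_hermiteEval i x).mul (hasDerivAt_gaussWeight x)).congr_deriv ?_
    ring
  have h := integral_eq_zero_of_hasDerivAt_of_integrable hd (hi _).neg (hi _)
  rwa [integral_neg, neg_eq_zero] at h

/-- Orthogonality of the Hermite polynomials with respect to the Gaussian weight. -/
theorem integral_hermiteEval_mul (i j : ℕ) :
    ∫ x, hermiteEval i x * hermiteEval j x * gaussWeight x =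
      if i = j then (i.factorial : ℝ) * Real.sqrt (2 * Real.pi) else 0 := by
  induction i generalizing j with
  | zero =>
    cases j with
    | zero => simp [hermiteEval_zero, integral_gaussWeight]
    | succ j => simp [hermiteEval_zero, integral_hermiteEval_succ]
  | succ i ih =>
    cases j with
    | zero => simp [hermiteEval_zero, integral_hermiteEval_succ]
    | succ j =>
      rw [integral_hermiteEval_succ_mul_succ, ih]
      by_cases h : i = j
      · subst h
        simp [Nat.factorial_succ, mul_assoc]
      · simp [h]

theorem integrable_add_I_pow (x : ℝ) (j : ℕ) :
    Integrable fun z : ℝ => ((x : ℂ) + Complex.I * z) ^ j * gaussWeight z := by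
  have e : (fun z : ℝ => ((x : ℂ) + Complex.I * z) ^ j * gaussWeight z) = fun z : ℝ =>
      ∑ i ∈ Finset.range (j + 1), ((x : ℂ) ^ i * Complex.I ^ (j - i) * (j.choose i : ℂ)) *
        ((z ^ (j - i) * gaussWeight z : ℝ) : ℂ) := by
    funext z
    rw [add_pow, Finset.sum_mul]
    refine Finset.sum_congr rfl fun i _ => ?_
    push_cast
    ring
  rw [e]
  exact integrable_finsetSum _ fun i _ => (integrable_pow_mul_gaussWeight _).ofReal.const_mul _

/-- The moments `∫ (x + iz)ʲ e^{-z²/2} dz` satisfy the three-term recurrence of the Hermite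
polynomials, by integration by parts. -/
theorem integral_add_I_pow_succ_succ (x : ℝ) (j : ℕ) :
    ∫ z : ℝ, ((x : ℂ) + Complex.I * z) ^ (j + 2) * gaussWeight z =
      x * (∫ z : ℝ, ((x : ℂ) + Complex.I * z) ^ (j + 1) * gaussWeight z) -
        (j + 1) * ∫ z : ℝ, ((x : ℂ) + Complex.I * z) ^ j * gaussWeight z := by
  have hd : ∀ z : ℝ, HasDerivAt
      (fun z : ℝ => Complex.I * (((x : ℂ) + Complex.I * z) ^ (j + 1) * gaussWeight z))
      (x * (((x : ℂ) + Complex.I * z) ^ (j + 1) * gaussWeight z) -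
        (j + 1) * (((x : ℂ) + Complex.I * z) ^ j * gaussWeight z) -
        ((x : ℂ) + Complex.I * z) ^ (j + 2) * gaussWeight z) z := by
    intro z
    have h1 : HasDerivAt (fun z : ℝ => (x : ℂ) + Complex.I * z) Complex.I z := by
      have := ((Complex.ofRealCLM.hasDerivAt (x := z)).const_mul Complex.I).const_add (x : ℂ)
      simpa using this
    have h2 := h1.pow (j + 1)
    have h3 := (hasDerivAt_gaussWeight z).ofReal_comp
    refine ((h2.mul h3).const_mul Complex.I).congr_deriv ?_
    simp only [Pi.pow_apply, add_tsub_cancel_right]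
    push_cast
    have hI : Complex.I * Complex.I = -1 := Complex.I_mul_I
    linear_combination ((j + 1) * ((x : ℂ) + Complex.I * z) ^ j * gaussWeight z) * hI
  have hi := integrable_add_I_pow x
  have h1 := (hi (j + 1)).const_mul (x : ℂ)
  have h2 := (hi j).const_mul ((j : ℂ) + 1)
  have h12 : Integrable fun z : ℝ => x * (((x : ℂ) + Complex.I * z) ^ (j + 1) * gaussWeight z) -
      (j + 1) * (((x : ℂ) + Complex.I * z) ^ j * gaussWeight z) := h1.sub h2
  have h := integral_eq_zero_of_hasDerivAt_of_integrable hd (h12.sub (hi _)) ((hi _).const_mul _)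
  rw [integral_sub h12 (hi _), integral_sub h1 h2, integral_const_mul, integral_const_mul] at h
  linear_combination -h

/-- The Hermite polynomials are Gaussian moments: `∫ (x + iz)ʲ e^{-z²/2} dz = √(2π) He_j(x)`. -/
theorem integral_add_I_pow (x : ℝ) (j : ℕ) :
    ∫ z : ℝ, ((x : ℂ) + Complex.I * z) ^ j * gaussWeight z =
      Real.sqrt (2 * Real.pi) * hermiteEval j x := by
  have h0 : ∫ z : ℝ, (gaussWeight z : ℂ) = Real.sqrt (2 * Real.pi) := by
    rw [integral_complex_ofReal, integral_gaussWeight]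
  induction j using Nat.twoStepInduction with
  | zero => simp [h0, hermiteEval_zero]
  | one =>
    have hodd : ∫ z : ℝ, ((z * gaussWeight z : ℝ) : ℂ) = 0 := by
      have := integral_hermiteEval_succ 0
      simp only [zero_add, hermiteEval_one] at this
      rw [integral_complex_ofReal, this, Complex.ofReal_zero]
    have e : ∀ z : ℝ, ((x : ℂ) + Complex.I * z) ^ 1 * gaussWeight z =
        x * (gaussWeight z : ℂ) + Complex.I * ((z * gaussWeight z : ℝ) : ℂ) := by
      intro z; push_cast; ring
    simp only [e]
    rw [integral_add, integral_const_mul, integral_const_mul, h0, hodd, hermiteEval_one]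
    · ring
    · simpa using (integrable_pow_mul_gaussWeight 0).ofReal.const_mul (x : ℂ)
    · simpa using (integrable_pow_mul_gaussWeight 1).ofReal.const_mul Complex.I
  | more j ih1 ih2 =>
    rw [integral_add_I_pow_succ_succ, ih1, ih2, hermiteEval_succ_succ]
    push_cast
    ring

end HermitePoly

/-! ### Mehler's formula -/

section Mehler

theorem ofReal_cpow_half {a : ℝ} (ha : 0 ≤ a) : (a : ℂ) ^ (1 / 2 : ℂ) = (Real.sqrt a : ℝ) := by
  rw [Real.sqrt_eq_rpow, Complex.ofReal_cpow ha]
  norm_num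

/-- The Gaussian average of `exp(s (y + i w))` over `w`. -/
theorem integral_exp_add_I (s : ℂ) (y : ℝ) :
    ∫ w : ℝ, Complex.exp (s * (y + Complex.I * w)) * gaussWeight w =
      Real.sqrt (2 * Real.pi) * Complex.exp (s * y - s ^ 2 / 2) := by
  have h := integral_cexp_quadratic (b := -1 / 2) (by norm_num) (Complex.I * s) (s * y)
  have e : (Real.pi / -(-1 / 2) : ℂ) = ((2 * Real.pi : ℝ) : ℂ) := by push_cast; ring
  rw [e, ofReal_cpow_half (by positivity)] at h
  have e2 : s * y - (Complex.I * s) ^ 2 / (4 * (-1 / 2)) = s * y - s ^ 2 / 2 := by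
    rw [mul_pow, Complex.I_sq]; ring
  rw [e2] at h
  rw [← h]
  refine integral_congr_ae (ae_of_all _ fun w => ?_)
  simp only [gaussWeight, Complex.ofReal_exp, ← Complex.exp_add]
  congr 1
  push_cast
  ring

/-- The remaining Gaussian integral over `z`, once `exp(r (x + i z) (y + i w))` is averaged over
`w`. -/
theorem integral_exp_quadratic_mehler {r : ℝ} (hr : r ^ 2 < 1) (x y : ℝ) :
    ∫ z : ℝ, Complex.exp (r * (x + Complex.I * z) * y - (r * (x + Complex.I * z)) ^ 2 / 2) *
        gaussWeight z =
      Real.sqrt (2 * Real.pi / (1 - r ^ 2)) *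
        Complex.exp ((2 * r * x * y - r ^ 2 * x ^ 2 - r ^ 2 * y ^ 2) / (2 * (1 - r ^ 2))) := by
  have h1 : 0 < 1 - r ^ 2 := by linarith
  have h1' : (1 - (r : ℂ) ^ 2) ≠ 0 := by exact_mod_cast h1.ne'
  have hb : (((-(1 - r ^ 2) / 2 : ℝ) : ℂ)).re < 0 := by
    rw [Complex.ofReal_re]; linarith
  have h := integral_cexp_quadratic hb (Complex.I * (r * y - r ^ 2 * x))
    (r * x * y - r ^ 2 * x ^ 2 / 2)
  have e : (Real.pi / -((-(1 - r ^ 2) / 2 : ℝ) : ℂ)) = ((2 * Real.pi / (1 - r ^ 2) : ℝ) : ℂ) := by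
    push_cast
    field_simp
  rw [e, ofReal_cpow_half (by positivity)] at h
  have e2 : (r * x * y - r ^ 2 * x ^ 2 / 2 : ℂ) - (Complex.I * (r * y - r ^ 2 * x)) ^ 2 /
      (4 * ((-(1 - r ^ 2) / 2 : ℝ) : ℂ)) =
      (2 * r * x * y - r ^ 2 * x ^ 2 - r ^ 2 * y ^ 2) / (2 * (1 - r ^ 2)) := by
    rw [mul_pow, Complex.I_sq]
    push_cast
    field_simp
    ring
  rw [e2] at h
  rw [← h]
  refine integral_congr_ae (ae_of_all _ fun w => ?_)
  simp only [gaussWeight, Complex.ofReal_exp, ← Complex.exp_add]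
  congr 1
  push_cast
  have hI : Complex.I ^ 2 = -1 := Complex.I_sq
  linear_combination (-(r : ℂ) ^ 2 * w ^ 2 / 2) * hI

/-- The majorant which allows the exponential series of `exp(r (x + i z) (y + i w))` to be
integrated term by term. It is integrable because `r a b ≤ r (a² + b²) / 2` and `r < 1`. -/
theorem integrable_exp_mul_gaussWeight {r : ℝ} (hr0 : 0 ≤ r) (hr : r < 1) (x y : ℝ) :
    Integrable (fun p : ℝ × ℝ => Real.exp (r * ‖(x : ℂ) + Complex.I * p.1‖ *
      ‖(y : ℂ) + Complex.I * p.2‖) * (gaussWeight p.1 * gaussWeight p.2)) (volume.prod volume) := by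
  have hg := integrable_exp_neg_mul_sq (b := (1 - r) / 2) (by linarith)
  refine ((hg.mul_prod hg).const_mul (Real.exp (r * (x ^ 2 + y ^ 2) / 2))).mono' ?_
    (ae_of_all _ fun p => ?_)
  · refine Continuous.aestronglyMeasurable ?_
    have := continuous_gaussWeight
    fun_prop
  · have hn : ∀ a b : ℝ, ‖(a : ℂ) + Complex.I * b‖ ^ 2 = a ^ 2 + b ^ 2 := fun a b => by
      rw [← Complex.normSq_eq_norm_sq, mul_comm, Complex.normSq_add_mul_I]
    rw [Real.norm_of_nonneg (by unfold gaussWeight; positivity)]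
    simp only [gaussWeight, ← Real.exp_add]
    refine Real.exp_le_exp.2 ?_
    have h1 := hn x p.1
    have h2 := hn y p.2
    set a := ‖(x : ℂ) + Complex.I * p.1‖
    set b := ‖(y : ℂ) + Complex.I * p.2‖
    nlinarith [mul_nonneg hr0 (sq_nonneg (a - b))]

/-- **Mehler's formula** for the probabilists' Hermite polynomials, obtained by averaging the
exponential series of `exp(r (x + i z) (y + i w))` term by term over a standard Gaussian pair
`(z, w)`. -/
theorem hasSum_mehler {r : ℝ} (hr0 : 0 ≤ r) (hr : r < 1) (x y : ℝ) :
    HasSum (fun j : ℕ => r ^ j / j.factorial * (hermiteEval j x * hermiteEval j y))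
      ((Real.sqrt (1 - r ^ 2))⁻¹ *
        Real.exp ((2 * r * x * y - r ^ 2 * x ^ 2 - r ^ 2 * y ^ 2) / (2 * (1 - r ^ 2)))) := by
  have hr2 : r ^ 2 < 1 := by nlinarith
  set A : ℝ × ℝ → ℂ := fun p => (x : ℂ) + Complex.I * p.1
  set B : ℝ × ℝ → ℂ := fun p => (y : ℂ) + Complex.I * p.2
  set g : ℝ × ℝ → ℝ := fun p => gaussWeight p.1 * gaussWeight p.2
  have hg0 : ∀ p, 0 ≤ g p := fun p => by simp only [g, gaussWeight]; positivity
  have hAc : Continuous A := by fun_prop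
  have hBc : Continuous B := by fun_prop
  have hgc : Continuous g := by
    have := continuous_gaussWeight
    fun_prop
  set F : ℕ → ℝ × ℝ → ℂ := fun j p => (r * A p * B p) ^ j / j.factorial * g p
  have hsum : ∀ p, HasSum (fun j => ‖F j p‖) (Real.exp (r * ‖A p‖ * ‖B p‖) * g p) := by
    intro p
    have h := (NormedSpace.expSeries_div_hasSum_exp (r * ‖A p‖ * ‖B p‖)).mul_right (g p)
    rw [← Real.exp_eq_exp_ℝ] at h
    have e : (fun j => ‖F j p‖) = fun j => (r * ‖A p‖ * ‖B p‖) ^ j / j.factorial * g p := by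
      funext j
      simp only [F, norm_mul, norm_div, norm_pow, Complex.norm_real, Real.norm_of_nonneg hr0,
        Real.norm_of_nonneg (hg0 p), Complex.norm_natCast]
    rwa [e]
  have hF : HasSum (fun j => ∫ p, F j p) (∫ p, Complex.exp (r * A p * B p) * g p) := by
    refine hasSum_integral_of_dominated_convergence (fun j p => ‖F j p‖) (fun j => ?_)
      (fun j => ae_of_all _ fun p => le_rfl) (ae_of_all _ fun p => (hsum p).summable) ?_
      (ae_of_all _ fun p => ?_)
    · exact Continuous.aestronglyMeasurable (by fun_prop)
    · simp only [(hsum _).tsum_eq]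
      exact integrable_exp_mul_gaussWeight hr0 hr x y
    · have h := (NormedSpace.expSeries_div_hasSum_exp ((r : ℂ) * A p * B p)).mul_right (g p : ℂ)
      rwa [← Complex.exp_eq_exp_ℂ] at h
  have hFj : ∀ j, ∫ p, F j p = ((2 * Real.pi * (r ^ j / j.factorial *
      (hermiteEval j x * hermiteEval j y)) : ℝ) : ℂ) := by
    intro j
    have e : ∀ p, F j p = ((r : ℂ) ^ j / j.factorial) *
        ((((x : ℂ) + Complex.I * p.1) ^ j * gaussWeight p.1) *
          (((y : ℂ) + Complex.I * p.2) ^ j * gaussWeight p.2)) := by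
      intro p
      simp only [F, A, B, g, mul_pow]
      push_cast
      ring
    simp only [e]
    rw [integral_const_mul, Measure.volume_eq_prod, integral_prod_mul
      (fun z : ℝ => ((x : ℂ) + Complex.I * z) ^ j * gaussWeight z)
      (fun z : ℝ => ((y : ℂ) + Complex.I * z) ^ j * gaussWeight z), integral_add_I_pow,
      integral_add_I_pow]
    have hs : (Real.sqrt (2 * Real.pi) : ℂ) * Real.sqrt (2 * Real.pi) = 2 * Real.pi := by
      rw [← Complex.ofReal_mul, Real.mul_self_sqrt (by positivity)]
      push_cast; ring
    push_cast
    linear_combination ((r : ℂ) ^ j / j.factorial * hermiteEval j x * hermiteEval j y) * hs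
  have hlim : ∫ p, Complex.exp (r * A p * B p) * g p = ((2 * Real.pi *
      ((Real.sqrt (1 - r ^ 2))⁻¹ * Real.exp ((2 * r * x * y - r ^ 2 * x ^ 2 - r ^ 2 * y ^ 2) /
        (2 * (1 - r ^ 2)))) : ℝ) : ℂ) := by
    have hint : Integrable (fun p => Complex.exp (r * A p * B p) * g p) (volume.prod volume) := by
      refine (integrable_exp_mul_gaussWeight hr0 hr x y).mono'
        (Continuous.aestronglyMeasurable (by fun_prop)) (ae_of_all _ fun p => ?_)
      rw [norm_mul, Complex.norm_real, Real.norm_of_nonneg (hg0 p)]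
      refine mul_le_mul_of_nonneg_right ((Complex.norm_exp_le_exp_norm _).trans_eq ?_) (hg0 p)
      rw [norm_mul, norm_mul, Complex.norm_real, Real.norm_of_nonneg hr0]
    rw [Measure.volume_eq_prod, integral_prod _ hint]
    have e : ∀ z : ℝ, ∫ w : ℝ, Complex.exp (r * A (z, w) * B (z, w)) * g (z, w) =
        Real.sqrt (2 * Real.pi) * (Complex.exp (r * (x + Complex.I * z) * y -
          (r * (x + Complex.I * z)) ^ 2 / 2) * gaussWeight z) := by
      intro z
      have h := integral_exp_add_I (r * (x + Complex.I * z)) y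
      rw [← mul_assoc, ← h, ← integral_mul_const]
      refine integral_congr_ae (ae_of_all _ fun w => ?_)
      simp only [A, B, g]
      push_cast
      ring
    simp only [e]
    rw [integral_const_mul, integral_exp_quadratic_mehler hr2,
      Real.sqrt_div (by positivity)]
    have hs : (Real.sqrt (2 * Real.pi) : ℂ) * Real.sqrt (2 * Real.pi) = 2 * Real.pi := by
      rw [← Complex.ofReal_mul, Real.mul_self_sqrt (by positivity)]
      push_cast; ring
    push_cast
    rw [← hs]
    ring
  simp only [hFj, hlim] at hF
  have h := Complex.hasSum_ofReal.1 hF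
  have h' := h.mul_left (2 * Real.pi)⁻¹
  have hpi : 2 * Real.pi ≠ 0 := by positivity
  simpa only [inv_mul_cancel_left₀ hpi] using h'

theorem hermiteFun_mul (j : ℕ) (x y : ℝ) :
    hermiteFun j x * hermiteFun j y = (Real.sqrt Real.pi)⁻¹ * Real.exp (-(x ^ 2 + y ^ 2) / 2) *
      (1 / j.factorial * (hermiteEval j (Real.sqrt 2 * x) * hermiteEval j (Real.sqrt 2 * y))) := by
  have hs : Real.sqrt (j.factorial * Real.sqrt Real.pi) *
      Real.sqrt (j.factorial * Real.sqrt Real.pi) = j.factorial * Real.sqrt Real.pi :=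
    Real.mul_self_sqrt (by positivity)
  have he : Real.exp (-(x ^ 2 + y ^ 2) / 2) = Real.exp (-x ^ 2 / 2) * Real.exp (-y ^ 2 / 2) := by
    rw [← Real.exp_add]; congr 1; ring
  have hs' : (Real.sqrt (j.factorial * Real.sqrt Real.pi))⁻¹ *
      (Real.sqrt (j.factorial * Real.sqrt Real.pi))⁻¹ =
        (Real.sqrt Real.pi)⁻¹ * (1 / j.factorial) := by
    rw [← mul_inv, hs, mul_inv, mul_comm, one_div]
  rw [he]
  unfold hermiteFun hermiteEval
  linear_combination (Polynomial.aeval (Real.sqrt 2 * x) (Polynomial.hermite j) *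
    Polynomial.aeval (Real.sqrt 2 * y) (Polynomial.hermite j) *
    Real.exp (-x ^ 2 / 2) * Real.exp (-y ^ 2 / 2)) * hs'

/-- **Mehler's formula** for the Hermite functions, in hyperbolic form, with `r = e^{-2s}`. -/
theorem hasSum_hermiteFun {s : ℝ} (hs : 0 < s) (x y : ℝ) :
    HasSum (fun j : ℕ => Real.exp (-(s * (2 * j + 1))) * (hermiteFun j x * hermiteFun j y))
      ((Real.sqrt (2 * Real.pi * Real.sinh (2 * s)))⁻¹ *
        Real.exp (-(1 / 4) * ((x + y) ^ 2 * Real.tanh s + (x - y) ^ 2 * coth s))) := by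
  have hr1 : Real.exp (-(2 * s)) < 1 := by
    rw [← Real.exp_zero]; exact Real.exp_lt_exp.2 (by linarith)
  have hr0 : 0 < Real.exp (-(2 * s)) := Real.exp_pos _
  have h := (hasSum_mehler hr0.le hr1 (Real.sqrt 2 * x) (Real.sqrt 2 * y)).mul_left
    (Real.exp (-s) * ((Real.sqrt Real.pi)⁻¹ * Real.exp (-(x ^ 2 + y ^ 2) / 2)))
  have e1 : (fun j : ℕ => Real.exp (-(s * (2 * j + 1))) * (hermiteFun j x * hermiteFun j y)) =
      fun j : ℕ => Real.exp (-s) * ((Real.sqrt Real.pi)⁻¹ * Real.exp (-(x ^ 2 + y ^ 2) / 2)) *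
        (Real.exp (-(2 * s)) ^ j / j.factorial * (hermiteEval j (Real.sqrt 2 * x) *
          hermiteEval j (Real.sqrt 2 * y))) := by
    funext j
    have e : Real.exp (-(s * (2 * j + 1))) = Real.exp (-s) * Real.exp (-(2 * s)) ^ j := by
      rw [← Real.exp_nat_mul, ← Real.exp_add]; congr 1; ring
    rw [hermiteFun_mul, e]
    ring
  rw [e1]
  have hr2 : 0 < 1 - Real.exp (-(2 * s)) ^ 2 := by nlinarith
  -- The normalizing constants agree.
  have hc : (Real.sqrt (2 * Real.pi * Real.sinh (2 * s)))⁻¹ =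
      Real.exp (-s) * (Real.sqrt Real.pi)⁻¹ * (Real.sqrt (1 - Real.exp (-(2 * s)) ^ 2))⁻¹ := by
    have e2 : 2 * Real.pi * Real.sinh (2 * s) =
        (Real.exp s) ^ 2 * (Real.pi * (1 - Real.exp (-(2 * s)) ^ 2)) := by
      have h1 : Real.exp (2 * s) = Real.exp s ^ 2 := by rw [← Real.exp_nat_mul]; norm_num
      rw [Real.sinh_eq, Real.exp_neg, h1]
      field_simp
    rw [e2, Real.sqrt_mul (by positivity), Real.sqrt_sq (Real.exp_pos s).le,
      Real.sqrt_mul Real.pi_pos.le, Real.exp_neg s]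
    simp only [mul_inv, mul_assoc]
  -- The exponents agree; both sides are rational functions of `a = eˢ`.
  have hx : -(1 / 4) * ((x + y) ^ 2 * Real.tanh s + (x - y) ^ 2 * coth s) =
      -(x ^ 2 + y ^ 2) / 2 + (2 * Real.exp (-(2 * s)) * (Real.sqrt 2 * x) * (Real.sqrt 2 * y) -
        Real.exp (-(2 * s)) ^ 2 * (Real.sqrt 2 * x) ^ 2 -
        Real.exp (-(2 * s)) ^ 2 * (Real.sqrt 2 * y) ^ 2) /
          (2 * (1 - Real.exp (-(2 * s)) ^ 2)) := by
    have h2 : Real.sqrt 2 ^ 2 = 2 := Real.sq_sqrt (by norm_num)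
    have hE : 1 < Real.exp s := Real.one_lt_exp_iff.2 hs
    have hr : Real.exp (-(2 * s)) = (Real.exp s ^ 2)⁻¹ := by
      rw [Real.exp_neg, ← Real.exp_nat_mul]; norm_num
    have e3 : 2 * Real.exp (-(2 * s)) * (Real.sqrt 2 * x) * (Real.sqrt 2 * y) -
        Real.exp (-(2 * s)) ^ 2 * (Real.sqrt 2 * x) ^ 2 -
        Real.exp (-(2 * s)) ^ 2 * (Real.sqrt 2 * y) ^ 2 =
        2 * (2 * Real.exp (-(2 * s)) * x * y - Real.exp (-(2 * s)) ^ 2 * (x ^ 2 + y ^ 2)) := by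
      linear_combination (2 * Real.exp (-(2 * s)) * x * y - Real.exp (-(2 * s)) ^ 2 *
        (x ^ 2 + y ^ 2)) * h2
    rw [e3, Real.tanh_eq_sinh_div_cosh, coth, Real.sinh_eq, Real.cosh_eq, Real.exp_neg s, hr]
    set a := Real.exp s
    have ha0 : a ≠ 0 := by linarith
    have ha1 : a ^ 2 - 1 ≠ 0 := by nlinarith
    have ha2 : a ^ 2 + 1 ≠ 0 := by nlinarith
    have ha3 : a ^ 4 - 1 ≠ 0 := by
      rw [show a ^ 4 - 1 = (a ^ 2 - 1) * (a ^ 2 + 1) by ring]; exact mul_ne_zero ha1 ha2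
    have e4 : (a - a⁻¹) / 2 / ((a + a⁻¹) / 2) = (a ^ 2 - 1) / (a ^ 2 + 1) := by field_simp
    have e5 : (a + a⁻¹) / 2 / ((a - a⁻¹) / 2) = (a ^ 2 + 1) / (a ^ 2 - 1) := by field_simp
    have e6 : 2 * (2 * (a ^ 2)⁻¹ * x * y - (a ^ 2)⁻¹ ^ 2 * (x ^ 2 + y ^ 2)) /
        (2 * (1 - (a ^ 2)⁻¹ ^ 2)) = (2 * a ^ 2 * x * y - (x ^ 2 + y ^ 2)) / (a ^ 4 - 1) := by
      field_simp
    rw [e4, e5, e6]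
    field_simp
    ring
  have hval : ∀ a b c d e : ℝ, a * b * c * (d * e) = a * (b * d) * (c * e) := fun _ _ _ _ _ => by
    ring
  rw [hc, hx, Real.exp_add, hval]
  exact h

/-- Orthonormality of the one-dimensional Hermite functions. -/
theorem integral_hermiteFun_mul (i j : ℕ) :
    ∫ u, hermiteFun i u * hermiteFun j u = if i = j then 1 else 0 := by
  set c : ℕ → ℝ := fun j => (Real.sqrt (j.factorial * Real.sqrt Real.pi))⁻¹
  have e : ∀ u, hermiteFun i u * hermiteFun j u = (c i * c j) *
      (hermiteEval i (Real.sqrt 2 * u) * hermiteEval j (Real.sqrt 2 * u) *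
        gaussWeight (Real.sqrt 2 * u)) := by
    intro u
    have hg : gaussWeight (Real.sqrt 2 * u) = Real.exp (-u ^ 2 / 2) * Real.exp (-u ^ 2 / 2) := by
      rw [gaussWeight, ← Real.exp_add, mul_pow, Real.sq_sqrt (by norm_num)]
      congr 1; ring
    rw [hg]
    unfold hermiteFun hermiteEval
    ring
  simp only [e]
  rw [integral_const_mul, Measure.integral_comp_mul_left
    (fun u => hermiteEval i u * hermiteEval j u * gaussWeight u), integral_hermiteEval_mul]
  by_cases h : i = j
  · subst h
    have hs : c i * c i = ((i.factorial : ℝ) * Real.sqrt Real.pi)⁻¹ := by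
      simp only [c]
      rw [← mul_inv, Real.mul_self_sqrt (by positivity)]
    rw [hs, Real.sqrt_mul (by norm_num), smul_eq_mul, abs_of_pos (by positivity)]
    have : Real.sqrt Real.pi ≠ 0 := by positivity
    simp
    field_simp
  · simp [h]

theorem continuous_hermiteFun (j : ℕ) : Continuous (hermiteFun j) := by
  have := continuous_hermiteEval j
  unfold hermiteFun
  change Continuous fun u => _ * hermiteEval j (Real.sqrt 2 * u) * _
  fun_prop

end Mehler

/-! ### Scaled Hermite functions in several variables -/

section Scaled

/-- A product of convergent series is the sum over multi-indices of the products of terms. -/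
theorem hasSum_pi_prod {m : ℕ} {f : Fin m → ℕ → ℝ} {a : Fin m → ℝ}
    (hf : ∀ i, HasSum (f i) (a i)) :
    HasSum (fun k : Fin m → ℕ => ∏ i, f i (k i)) (∏ i, a i) := by
  induction m with
  | zero => simp [hasSum_unique]
  | succ m ih =>
    have h := ih (f := fun i => f i.succ) (a := fun i => a i.succ) fun i => hf i.succ
    have hs := summable_mul_of_summable_norm (hf 0).summable.norm h.summable.norm
    have h2 := (hf 0).mul h hs
    rw [Fin.prod_univ_succ, ← (Fin.consEquiv fun _ : Fin (m + 1) => ℕ).hasSum_iff]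
    have e : (fun k : Fin (m + 1) → ℕ => ∏ i, f i (k i)) ∘ (Fin.consEquiv fun _ => ℕ) =
        fun p : ℕ × (Fin m → ℕ) => f 0 p.1 * ∏ i : Fin m, f i.succ (p.2 i) := by
      funext p
      simp [Fin.prod_univ_succ, Fin.consEquiv]
    rwa [e]

/-- The decay factor `exp(-tΘ)` of the `k`-th Hermite coefficient at frequency `τ = |ξ|`. -/
def heatFactor {m : ℕ} (t τ : ℝ) (k : Fin m → ℕ) : ℝ :=
  Real.exp (-t * ((2 * ((∑ i, k i : ℕ) : ℝ) + m) * τ))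

theorem heatFactor_pos {m : ℕ} (t τ : ℝ) (k : Fin m → ℕ) : 0 < heatFactor t τ k := Real.exp_pos _

theorem heatFactor_eq_prod {m : ℕ} (t τ : ℝ) (k : Fin m → ℕ) :
    heatFactor t τ k = ∏ i, Real.exp (-(t * τ * (2 * k i + 1))) := by
  rw [heatFactor, ← Real.exp_sum]
  congr 1
  rw [Finset.sum_neg_distrib, ← Finset.mul_sum, Finset.sum_add_distrib, ← Finset.mul_sum]
  simp
  ring

theorem summable_heatFactor {m : ℕ} {t τ : ℝ} (ht : 0 < t) (hτ : 0 < τ) :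
    Summable (heatFactor (m := m) t τ) := by
  have h : ∀ _i : Fin m, Summable fun j : ℕ => Real.exp (-(t * τ * (2 * j + 1))) := by
    intro _
    have h0 := (summable_geometric_of_lt_one (Real.exp_pos (-(t * τ * 2))).le
      (by rw [← Real.exp_zero]; exact Real.exp_lt_exp.2 (by nlinarith [mul_pos ht hτ]))).mul_left
        (Real.exp (-(t * τ)))
    refine h0.congr fun j => ?_
    rw [← Real.exp_nat_mul, ← Real.exp_add]
    congr 1
    ring
  have := (hasSum_pi_prod fun i => (h i).hasSum).summable
  exact this.congr fun k => (heatFactor_eq_prod t τ k).symm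

/-- The Mehler kernel, the integral kernel of the fibre of `exp(-t𝔾)` at frequency `τ = |ξ|`. -/
def mehlerKernel {m : ℕ} (t τ : ℝ) (x y : E m) : ℝ :=
  (τ / (2 * Real.pi * Real.sinh (2 * (t * τ)))) ^ ((m : ℝ) / 2) *
    Real.exp (-(τ / 4) * (‖x + y‖ ^ 2 * Real.tanh (t * τ) + ‖x - y‖ ^ 2 * coth (t * τ)))

variable {m : ℕ}

theorem scaledHermite_mul (k l : Fin m → ℕ) {τ : ℝ} (hτ : 0 < τ) (x y : E m) :
    scaledHermite k τ x * scaledHermite l τ y =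
      τ ^ ((m : ℝ) / 2) * ∏ i, hermiteFun (k i) (Real.sqrt τ * x i) *
        hermiteFun (l i) (Real.sqrt τ * y i) := by
  have h : τ ^ ((m : ℝ) / 2) = τ ^ ((m : ℝ) / 4) * τ ^ ((m : ℝ) / 4) := by
    rw [← Real.rpow_add hτ]; congr 1; ring
  rw [h, Finset.prod_mul_distrib]
  simp only [scaledHermite, hermiteFunMulti, PiLp.smul_apply, smul_eq_mul]
  ring

/-- **Mehler's formula** for the scaled Hermite functions on `ℝᵐ`: the product over the coordinates
of the one-dimensional formula at `s = tτ`. -/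
theorem hasSum_scaledHermite {t τ : ℝ} (ht : 0 < t) (hτ : 0 < τ) (x y : E m) :
    HasSum (fun k : Fin m → ℕ => heatFactor t τ k * (scaledHermite k τ x * scaledHermite k τ y))
      (mehlerKernel t τ x y) := by
  have hs : 0 < t * τ := mul_pos ht hτ
  have hsinh : 0 < Real.sinh (2 * (t * τ)) := Real.sinh_pos_iff.2 (by linarith)
  have h := (hasSum_pi_prod fun i : Fin m =>
    hasSum_hermiteFun hs (Real.sqrt τ * x i) (Real.sqrt τ * y i)).mul_left (τ ^ ((m : ℝ) / 2))
  have e1 : (fun k : Fin m → ℕ => heatFactor t τ k *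
      (scaledHermite k τ x * scaledHermite k τ y)) = fun k : Fin m → ℕ => τ ^ ((m : ℝ) / 2) *
        ∏ i, Real.exp (-(t * τ * (2 * k i + 1))) *
          (hermiteFun (k i) (Real.sqrt τ * x i) * hermiteFun (k i) (Real.sqrt τ * y i)) := by
    funext k
    rw [scaledHermite_mul k k hτ, heatFactor_eq_prod, Finset.prod_mul_distrib (f := fun i =>
      Real.exp (-(t * τ * (2 * k i + 1))))]
    ring
  have e2 : mehlerKernel t τ x y = τ ^ ((m : ℝ) / 2) *
      ∏ i, (Real.sqrt (2 * Real.pi * Real.sinh (2 * (t * τ))))⁻¹ *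
        Real.exp (-(1 / 4) * ((Real.sqrt τ * x i + Real.sqrt τ * y i) ^ 2 * Real.tanh (t * τ) +
          (Real.sqrt τ * x i - Real.sqrt τ * y i) ^ 2 * coth (t * τ))) := by
    rw [Finset.prod_mul_distrib, ← Real.exp_sum, Finset.prod_const, Finset.card_univ,
      Fintype.card_fin, mehlerKernel, Real.div_rpow hτ.le (by positivity), inv_pow,
      div_eq_mul_inv, mul_assoc]
    have e3 : Real.sqrt (2 * Real.pi * Real.sinh (2 * (t * τ))) ^ m =
        (2 * Real.pi * Real.sinh (2 * (t * τ))) ^ ((m : ℝ) / 2) := by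
      rw [Real.sqrt_eq_rpow, ← Real.rpow_natCast, ← Real.rpow_mul (by positivity)]
      congr 1
      ring
    rw [e3]
    congr 3
    rw [EuclideanSpace.norm_sq_eq, EuclideanSpace.norm_sq_eq, Finset.sum_mul, Finset.sum_mul,
      ← Finset.sum_add_distrib, Finset.mul_sum]
    refine Finset.sum_congr rfl fun i _ => ?_
    have hq : Real.sqrt τ ^ 2 = τ := Real.sq_sqrt hτ.le
    simp only [PiLp.add_apply, PiLp.sub_apply, Real.norm_eq_abs, sq_abs]
    linear_combination ((x i + y i) ^ 2 * Real.tanh (t * τ) + (x i - y i) ^ 2 * coth (t * τ)) / 4 *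
      hq
  rw [e1, e2]
  exact h

theorem continuous_scaledHermite (k : Fin m → ℕ) (τ : ℝ) : Continuous (scaledHermite k τ) := by
  unfold scaledHermite hermiteFunMulti
  have := fun j => continuous_hermiteFun j
  fun_prop

/-- Orthonormality of the scaled Hermite functions for each fixed `τ`. -/
theorem integral_scaledHermite_mul (k l : Fin m → ℕ) {τ : ℝ} (hτ : 0 < τ) :
    ∫ x : E m, scaledHermite k τ x * scaledHermite l τ x = if k = l then 1 else 0 := by
  have hmp := PiLp.volume_preserving_ofLp (Fin m)
  have h1 : ∫ x : E m, (∏ i, hermiteFun (k i) (x i) * hermiteFun (l i) (x i)) =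
      ∏ i, ∫ u, hermiteFun (k i) u * hermiteFun (l i) u := by
    rw [← integral_fintype_prod_volume_eq_prod
      (fun i u => hermiteFun (k i) u * hermiteFun (l i) u)]
    exact hmp.integral_comp (MeasurableEquiv.toLp 2 (Fin m → ℝ)).symm.measurableEmbedding
      (fun x : Fin m → ℝ => ∏ i, hermiteFun (k i) (x i) * hermiteFun (l i) (x i))
  have h2 := Measure.integral_comp_smul (volume : Measure (E m))
    (fun x : E m => ∏ i, hermiteFun (k i) (x i) * hermiteFun (l i) (x i)) (Real.sqrt τ)
  rw [finrank_euclideanSpace_fin, h1] at h2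
  simp only [PiLp.smul_apply, smul_eq_mul] at h2
  simp only [scaledHermite_mul k l hτ]
  rw [integral_const_mul, h2]
  have hq : τ ^ ((m : ℝ) / 2) * |(Real.sqrt τ ^ m)⁻¹| = 1 := by
    have : Real.sqrt τ ^ m = τ ^ ((m : ℝ) / 2) := by
      rw [Real.sqrt_eq_rpow, ← Real.rpow_natCast, ← Real.rpow_mul hτ.le]
      congr 1
      ring
    rw [this, abs_of_pos (by positivity), mul_inv_cancel₀ (by positivity)]
  rw [← mul_assoc, hq, one_mul]
  simp only [integral_hermiteFun_mul]
  by_cases h : k = l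
  · subst h; simp
  · obtain ⟨i, hi⟩ := Function.ne_iff.1 h
    rw [if_neg h]
    exact Finset.prod_eq_zero (Finset.mem_univ i) (if_neg hi)

theorem memLp_scaledHermite (k : Fin m → ℕ) {τ : ℝ} (hτ : 0 < τ) :
    MemLp (fun x : E m => (scaledHermite k τ x : ℂ)) 2 := by
  have hm : MemLp (fun x : E m => scaledHermite k τ x) 2 := ?_
  · exact hm.ofReal
  rw [memLp_two_iff_integrable_sq (continuous_scaledHermite k τ).aestronglyMeasurable]
  -- The integral of a non-integrable function is `0`, whereas this one is `1`.
  by_contra hni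
  have h := integral_scaledHermite_mul k k hτ
  simp only [← sq, integral_undef hni, if_true] at h
  exact one_ne_zero h.symm

/-- The scaled Hermite function as an element of `L²`. -/
def hermiteLp (k : Fin m → ℕ) {τ : ℝ} (hτ : 0 < τ) : Lp (α := E m) ℂ 2 volume :=
  (memLp_scaledHermite k hτ).toLp

theorem inner_hermiteLp (k : Fin m → ℕ) {τ : ℝ} (hτ : 0 < τ) {F : E m → ℂ} (hF : MemLp F 2) :
    inner ℂ (hermiteLp k hτ) hF.toLp = ∫ x, F x * (scaledHermite k τ x : ℂ) := by
  rw [L2.inner_def]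
  refine integral_congr_ae ?_
  filter_upwards [(memLp_scaledHermite k hτ).coeFn_toLp, hF.coeFn_toLp] with x h1 h2
  rw [hermiteLp, h1, h2]
  simp

theorem orthonormal_hermiteLp {τ : ℝ} (hτ : 0 < τ) :
    Orthonormal ℂ fun k : Fin m → ℕ => hermiteLp k hτ := by
  classical
  rw [orthonormal_iff_ite]
  intro k l
  have h := inner_hermiteLp k hτ (memLp_scaledHermite l hτ)
  have h2 := integral_scaledHermite_mul l k hτ
  rw [show hermiteLp l hτ = (memLp_scaledHermite l hτ).toLp from rfl, h]
  simp only [← Complex.ofReal_mul]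
  rw [integral_complex_ofReal, h2]
  by_cases hkl : k = l
  · simp [hkl]
  · simp [hkl, Ne.symm hkl]

end Scaled

/-! ### The Mehler operator on a fibre -/

section Fibre

/-- The sum of a series in `L²` agrees almost everywhere with its pointwise sum. -/
theorem ae_eq_tsum_of_hasSum {α ι : Type*} [MeasurableSpace α] {μ : Measure α} [Countable ι]
    {u : ι → Lp ℂ 2 μ} (hu : Summable u) {G : α → ℂ}
    (hG : ∀ᵐ x ∂μ, HasSum (fun i => u i x) (G x)) : ((∑' i, u i : Lp ℂ 2 μ) : α → ℂ) =ᵐ[μ] G := by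
  have h := tendstoInMeasure_of_tendsto_Lp (f := fun s : Finset ι => ∑ i ∈ s, u i) hu.hasSum
  obtain ⟨ns, hns, hlim⟩ := h.exists_seq_tendsto_ae'
  have hsum : ∀ᵐ x ∂μ, ∀ j, (∑ i ∈ ns j, u i : Lp ℂ 2 μ) x = ∑ i ∈ ns j, u i x := by
    rw [ae_all_iff]
    intro j
    filter_upwards [Lp.coeFn_finsetSum (ns j) u] with x hx
    rw [hx, Finset.sum_apply]
  filter_upwards [hlim, hG, hsum] with x h1 h2 h3
  simp only [h3] at h1
  have h2' : Tendsto (fun s : Finset ι => ∑ i ∈ s, u i x) _ (𝓝 (G x)) := h2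
  exact tendsto_nhds_unique h1 (h2'.comp hns)

variable {m : ℕ}

/-- The Hermite coefficient `⟨F, h_{k,τ}⟩`. -/
def hermiteCoeff (τ : ℝ) (F : E m → ℂ) (k : Fin m → ℕ) : ℂ :=
  ∫ x, F x * (scaledHermite k τ x : ℂ)

/-- The integral operator with the Mehler kernel. -/
def mehlerOp (t τ : ℝ) (F : E m → ℂ) (x : E m) : ℂ := ∫ y, (mehlerKernel t τ x y : ℂ) * F y

theorem lintegral_enorm_sq_eq {α : Type*} [MeasurableSpace α] {μ : Measure α} {F : α → ℂ}
    (hF : MemLp F 2 μ) : ∫⁻ x, ‖F x‖ₑ ^ 2 ∂μ = ENNReal.ofReal (‖hF.toLp‖ ^ 2) := by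
  rw [← eLpNorm_two_sq, Lp.norm_toLp, ENNReal.ofReal_pow ENNReal.toReal_nonneg,
    ENNReal.ofReal_toReal hF.2.ne]

/-- Bessel's inequality for the Hermite coefficients. -/
theorem tsum_hermiteCoeff_le {τ : ℝ} (hτ : 0 < τ) {F : E m → ℂ} (hF : MemLp F 2) :
    ∑' k, ‖hermiteCoeff τ F k‖ₑ ^ 2 ≤ ∫⁻ x, ‖F x‖ₑ ^ 2 := by
  rw [lintegral_enorm_sq_eq hF]
  rw [ENNReal.tsum_eq_iSup_sum]
  refine iSup_le fun s => ?_
  have h := (orthonormal_hermiteLp (m := m) hτ).sum_inner_products_le hF.toLp (s := s)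
  simp only [inner_hermiteLp] at h
  refine le_trans (le_of_eq ?_) (ENNReal.ofReal_le_ofReal h)
  rw [ENNReal.ofReal_sum_of_nonneg fun _ _ => by positivity]
  refine Finset.sum_congr rfl fun k _ => ?_
  rw [ENNReal.ofReal_pow (norm_nonneg _), ofReal_norm]
  rfl

/-- The Hermite series of the Mehler operator converges pointwise everywhere: Mehler's formula is
integrated term by term against `F`. -/
theorem hasSum_mehlerOp {t τ : ℝ} (ht : 0 < t) (hτ : 0 < τ) {F : E m → ℂ} (hF : MemLp F 2)
    (x : E m) : HasSum (fun k : Fin m → ℕ => (heatFactor t τ k : ℂ) * hermiteCoeff τ F k *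
      (scaledHermite k τ x : ℂ)) (mehlerOp t τ F x) := by
  set f : (Fin m → ℕ) → E m → ℂ := fun k y =>
    ((heatFactor t τ k * scaledHermite k τ x : ℝ) : ℂ) * (F y * (scaledHermite k τ y : ℂ))
  have hint : ∀ k, Integrable fun y => F y * (scaledHermite k τ y : ℂ) := fun k =>
    hF.integrable_mul (memLp_scaledHermite k hτ)
  have hF2 : Integrable fun y => ‖F y‖ ^ 2 := (memLp_two_iff_integrable_sq_norm hF.1).1 hF
  have hh2 : ∀ k : Fin m → ℕ, Integrable fun y : E m => scaledHermite k τ y ^ 2 := fun k =>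
    (memLp_two_iff_integrable_sq (continuous_scaledHermite k τ).aestronglyMeasurable).1
      (memLp_scaledHermite k hτ).re
  have hbound : ∀ k : Fin m → ℕ, ∫ y, ‖F y * (scaledHermite k τ y : ℂ)‖ ≤
      (∫ y, ‖F y‖ ^ 2) + 1 := by
    intro k
    have h1 : ∫ y, scaledHermite k τ y ^ 2 = 1 := by
      simpa [sq] using integral_scaledHermite_mul k k hτ
    rw [← h1, ← integral_add hF2 (hh2 k)]
    refine integral_mono (hint k).norm (hF2.add (hh2 k)) fun y => ?_
    simp only [norm_mul, Complex.norm_real]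
    have h3 : scaledHermite k τ y ^ 2 = ‖scaledHermite k τ y‖ ^ 2 := by simp
    rw [h3]
    nlinarith [sq_nonneg (‖F y‖ - ‖scaledHermite k τ y‖), sq_nonneg ‖F y‖,
      sq_nonneg ‖scaledHermite k τ y‖]
  -- The factor `|h_k(x)|` is at most `1 + h_k(x)²`, and `∑ₖ e^{-tΘ} h_k(x)²` converges by Mehler's
  -- formula on the diagonal.
  have hsum : Summable fun k => ∫ y, ‖f k y‖ := by
    have h0 := ((summable_heatFactor (m := m) ht hτ).add
      (hasSum_scaledHermite ht hτ x x).summable).mul_right ((∫ y, ‖F y‖ ^ 2) + 1)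
    refine Summable.of_nonneg_of_le (fun k => integral_nonneg fun y => norm_nonneg _)
      (fun k => ?_) h0
    simp only [f, norm_mul (Complex.ofReal _)]
    rw [integral_const_mul]
    refine mul_le_mul ?_ (hbound k) (integral_nonneg fun y => norm_nonneg _) ?_
    · rw [Complex.norm_real, norm_mul, Real.norm_of_nonneg (heatFactor_pos t τ k).le,
        ← mul_one_add]
      refine mul_le_mul_of_nonneg_left ?_ (heatFactor_pos t τ k).le
      rw [Real.norm_eq_abs]
      nlinarith [abs_mul_abs_self (scaledHermite k τ x), sq_nonneg (|scaledHermite k τ x| - 1)]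
    · have := (heatFactor_pos t τ k).le
      have := mul_self_nonneg (scaledHermite k τ x)
      positivity
  have h : HasSum (fun k => ∫ y, f k y) (∫ y, ∑' k, f k y) :=
    hasSum_integral_of_summable_integral_norm
      (fun k => (hint k).const_mul ((heatFactor t τ k * scaledHermite k τ x : ℝ) : ℂ)) hsum
  have e : ∫ y, ∑' k, f k y = mehlerOp t τ F x := by
    refine integral_congr_ae (ae_of_all _ fun y => ?_)
    have h1 := (Complex.hasSum_ofReal.2 (hasSum_scaledHermite ht hτ x y)).mul_right (F y)
    refine (HasSum.tsum_eq (f := fun k => f k y) ?_)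
    have e0 : (fun k => f k y) = fun k : Fin m → ℕ =>
        ((heatFactor t τ k * (scaledHermite k τ x * scaledHermite k τ y) : ℝ) : ℂ) * F y := by
      funext k
      simp only [f]
      push_cast
      ring
    rw [e0]
    exact h1
  have e' : ∀ k, ∫ y, f k y = (heatFactor t τ k : ℂ) * hermiteCoeff τ F k *
      (scaledHermite k τ x : ℂ) := by
    intro k
    simp only [f, hermiteCoeff]
    rw [integral_const_mul]
    push_cast
    ring
  rw [e] at h
  simpa only [e'] using h

/-- The `k`-th term `e^{-tΘ} ⟨F, h_{k,τ}⟩ h_{k,τ}` of the Hermite series, as an element of `L²`. -/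
def mehlerTerm (t : ℝ) {τ : ℝ} (hτ : 0 < τ) (F : E m → ℂ) (k : Fin m → ℕ) :
    Lp (α := E m) ℂ 2 volume :=
  ((heatFactor t τ k : ℂ) * hermiteCoeff τ F k) • hermiteLp k hτ

theorem coeFn_mehlerTerm (t : ℝ) {τ : ℝ} (hτ : 0 < τ) (F : E m → ℂ) (k : Fin m → ℕ) :
    mehlerTerm t hτ F k =ᵐ[volume] fun x =>
      (heatFactor t τ k : ℂ) * hermiteCoeff τ F k * (scaledHermite k τ x : ℂ) := by
  filter_upwards [Lp.coeFn_smul ((heatFactor t τ k : ℂ) * hermiteCoeff τ F k) (hermiteLp k hτ),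
    (memLp_scaledHermite k hτ).coeFn_toLp] with x h1 h2
  rw [mehlerTerm, h1, Pi.smul_apply, hermiteLp, h2, smul_eq_mul]

theorem summable_mehlerTerm {t τ : ℝ} (ht : 0 < t) (hτ : 0 < τ) {F : E m → ℂ} (hF : MemLp F 2) :
    Summable (mehlerTerm t hτ F) := by
  refine Summable.of_norm_bounded ((summable_heatFactor (m := m) ht hτ).mul_right ‖hF.toLp‖)
    fun k => ?_
  have hn := (orthonormal_hermiteLp (m := m) hτ).1 k
  rw [mehlerTerm, norm_smul, hn, mul_one, norm_mul, Complex.norm_real,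
    Real.norm_of_nonneg (heatFactor_pos t τ k).le]
  refine mul_le_mul_of_nonneg_left ?_ (heatFactor_pos t τ k).le
  rw [hermiteCoeff, ← inner_hermiteLp k hτ hF]
  simpa [hn] using norm_inner_le_norm (𝕜 := ℂ) (hermiteLp k hτ) hF.toLp

theorem tsum_mehlerTerm {t τ : ℝ} (ht : 0 < t) (hτ : 0 < τ) {F : E m → ℂ} (hF : MemLp F 2) :
    ((∑' k, mehlerTerm t hτ F k : Lp (α := E m) ℂ 2 volume) : E m → ℂ) =ᵐ[volume]
      mehlerOp t τ F := by
  refine ae_eq_tsum_of_hasSum (summable_mehlerTerm ht hτ hF) ?_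
  filter_upwards [ae_all_iff.2 fun k => coeFn_mehlerTerm t hτ F k] with x hx
  simpa only [hx] using hasSum_mehlerOp ht hτ hF x

/-- The Hermite series of the Mehler operator converges in `L²`. -/
theorem tendsto_eLpNorm_mehlerOp_sub {t τ : ℝ} (ht : 0 < t) (hτ : 0 < τ) {F : E m → ℂ}
    (hF : MemLp F 2) : Tendsto (fun s : Finset (Fin m → ℕ) => eLpNorm (fun x => mehlerOp t τ F x -
      ∑ k ∈ s, (heatFactor t τ k : ℂ) * hermiteCoeff τ F k * (scaledHermite k τ x : ℂ)) 2 volume)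
      atTop (𝓝 0) := by
  have h := (Lp.tendsto_Lp_iff_tendsto_eLpNorm' _ _).1 (summable_mehlerTerm ht hτ hF).hasSum
  refine h.congr fun s => ?_
  rw [← eLpNorm_neg]
  refine eLpNorm_congr_ae ?_
  filter_upwards [tsum_mehlerTerm ht hτ hF, Lp.coeFn_finsetSum s (mehlerTerm t hτ F),
    ae_all_iff.2 fun k => coeFn_mehlerTerm t hτ F k] with x h1 h2 h3
  simp only [Pi.neg_apply, Pi.sub_apply, neg_sub, h1, h2, Finset.sum_apply, h3]

/-- The Mehler operator is a contraction of `L²`, by Bessel's inequality and `e^{-tΘ} ≤ 1`. -/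
theorem lintegral_mehlerOp_le {t τ : ℝ} (ht : 0 < t) (hτ : 0 < τ) {F : E m → ℂ}
    (hF : MemLp F 2) : ∫⁻ x, ‖mehlerOp t τ F x‖ₑ ^ 2 ≤ ∫⁻ x, ‖F x‖ₑ ^ 2 := by
  rw [← eLpNorm_two_le_iff, ← eLpNorm_congr_ae (tsum_mehlerTerm ht hτ hF),
    ← eLpNorm_congr_ae hF.coeFn_toLp, ← ENNReal.toReal_le_toReal (Lp.eLpNorm_ne_top _)
      (Lp.eLpNorm_ne_top _), ← Lp.norm_def, ← Lp.norm_def]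
  refine le_of_tendsto (summable_mehlerTerm ht hτ hF).hasSum.norm (Eventually.of_forall fun s => ?_)
  have ho := orthonormal_hermiteLp (m := m) hτ
  have h1 := ho.sum_inner_products_le hF.toLp (s := s)
  simp only [inner_hermiteLp] at h1
  have h2 : ‖∑ k ∈ s, mehlerTerm t hτ F k‖ ^ 2 =
      ∑ k ∈ s, ‖(heatFactor t τ k : ℂ) * hermiteCoeff τ F k‖ ^ 2 := by
    have h3 := ho.inner_sum (fun k => (heatFactor t τ k : ℂ) * hermiteCoeff τ F k)
      (fun k => (heatFactor t τ k : ℂ) * hermiteCoeff τ F k) s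
    change inner ℂ (∑ k ∈ s, mehlerTerm t hτ F k) (∑ k ∈ s, mehlerTerm t hτ F k) = _ at h3
    rw [inner_self_eq_norm_sq_to_K] at h3
    simp only [Complex.conj_mul'] at h3
    rw [← Complex.ofReal_inj]
    push_cast
    exact h3
  refine le_of_sq_le_sq ?_ (norm_nonneg _)
  rw [h2]
  refine le_trans (Finset.sum_le_sum fun k _ => ?_) h1
  refine pow_le_pow_left₀ (norm_nonneg _) ?_ 2
  rw [norm_mul, Complex.norm_real, Real.norm_of_nonneg (heatFactor_pos t τ k).le]
  refine mul_le_of_le_one_left (norm_nonneg _) (Real.exp_le_one_iff.2 ?_)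
  have : 0 ≤ (2 * ((∑ i, k i : ℕ) : ℝ) + m) * τ := by positivity
  nlinarith

end Fibre

/-! ### Bounds for the Mehler kernel -/

section KernelBounds

variable {m n : ℕ}

theorem sinh_le_mul_exp {s : ℝ} : Real.sinh s ≤ s * Real.exp s := by
  have h := Real.add_one_le_exp (-(2 * s))
  have h2 : Real.exp (-s) = Real.exp s * Real.exp (-(2 * s)) := by
    rw [← Real.exp_add]; congr 1; ring
  rw [Real.sinh_eq, h2]
  nlinarith [Real.exp_pos s]

theorem exp_half_le_cosh (s : ℝ) : Real.exp s / 2 ≤ Real.cosh s := by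
  rw [Real.cosh_eq]
  linarith [Real.exp_pos (-s)]

/-- Near `0` one has `s coth s → 1`; the constant `1 / 2` is not optimal but suffices for Gaussian
decay of the Mehler kernel, uniformly in the frequency. -/
theorem le_mul_coth {s : ℝ} (hs : 0 < s) : 1 / 2 ≤ s * coth s := by
  have h1 : 0 < Real.sinh s := Real.sinh_pos_iff.2 hs
  rw [coth, ← mul_div_assoc, le_div_iff₀ h1]
  have := mul_le_mul_of_nonneg_left (exp_half_le_cosh s) hs.le
  have := sinh_le_mul_exp (s := s)
  linarith

theorem mul_exp_le_sinh_two_mul {s : ℝ} (hs : 0 ≤ s) : s * Real.exp s ≤ Real.sinh (2 * s) := by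
  rw [Real.sinh_two_mul]
  have h1 := Real.self_le_sinh_iff.2 hs
  have h2 := exp_half_le_cosh s
  have h3 := mul_le_mul h1 h2 (by positivity) (hs.trans h1)
  linarith

/-- The factor of the Mehler kernel that does not depend on the space variables. At `τ = 0`
the quotient is `0 / 0 = 0`, so that the factor vanishes for `m ≥ 1`; since `{0}` is a null set of
frequencies, this value is immaterial. -/
def kernelFactor (m : ℕ) (t τ : ℝ) : ℝ :=
  (τ / (2 * Real.pi * Real.sinh (2 * (t * τ)))) ^ ((m : ℝ) / 2)

theorem kernelFactor_nonneg {t τ : ℝ} (ht : 0 < t) (hτ : 0 ≤ τ) : 0 ≤ kernelFactor m t τ := by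
  have h : 0 ≤ Real.sinh (2 * (t * τ)) := Real.sinh_nonneg_iff.2 (by positivity)
  exact Real.rpow_nonneg (by positivity) _

theorem kernelFactor_zero (hm : 1 ≤ m) (t : ℝ) : kernelFactor m t 0 = 0 := by
  have : (m : ℝ) / 2 ≠ 0 := by
    have : (1 : ℝ) ≤ m := by exact_mod_cast hm
    positivity
  rw [kernelFactor, zero_div, Real.zero_rpow this]

/-- Exponential decay in the frequency. -/
theorem kernelFactor_le (hm : 1 ≤ m) {t τ : ℝ} (ht : 0 < t) (hτ : 0 ≤ τ) :
    kernelFactor m t τ ≤ (1 / (2 * Real.pi * t)) ^ ((m : ℝ) / 2) *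
      Real.exp (-(t * m / 2) * τ) := by
  rcases hτ.eq_or_lt with rfl | hτ
  · rw [kernelFactor_zero hm]
    positivity
  have hs : 0 < t * τ := mul_pos ht hτ
  have h1 := mul_exp_le_sinh_two_mul hs.le
  have h2 : τ / (2 * Real.pi * Real.sinh (2 * (t * τ))) ≤
      1 / (2 * Real.pi * t) * Real.exp (-(t * τ)) := by
    rw [Real.exp_neg, div_le_iff₀ (by
      have : 0 < Real.sinh (2 * (t * τ)) := lt_of_lt_of_le (by positivity) h1
      positivity)]
    have h3 : τ = 1 / (2 * Real.pi * t) * (Real.exp (t * τ))⁻¹ *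
        (2 * Real.pi * (t * τ * Real.exp (t * τ))) := by
      field_simp
    calc τ = _ := h3
      _ ≤ _ := by gcongr
  have h0 : 0 ≤ Real.sinh (2 * (t * τ)) := Real.sinh_nonneg_iff.2 (by positivity)
  calc kernelFactor m t τ ≤ (1 / (2 * Real.pi * t) * Real.exp (-(t * τ))) ^ ((m : ℝ) / 2) :=
        Real.rpow_le_rpow (by positivity) h2 (by positivity)
    _ = _ := by
        rw [Real.mul_rpow (by positivity) (by positivity), ← Real.exp_mul]
        congr 2
        ring

theorem mehlerKernel_eq (t τ : ℝ) (x y : E m) : mehlerKernel t τ x y = kernelFactor m t τ *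
    Real.exp (-(τ / 4) * (‖x + y‖ ^ 2 * Real.tanh (t * τ) + ‖x - y‖ ^ 2 * coth (t * τ))) := rfl

theorem mehlerKernel_nonneg {t τ : ℝ} (ht : 0 < t) (hτ : 0 ≤ τ) (x y : E m) :
    0 ≤ mehlerKernel t τ x y := mul_nonneg (kernelFactor_nonneg ht hτ) (Real.exp_pos _).le

/-- Gaussian decay of the Mehler kernel in `x - y`, uniformly in `τ`: the `tanh` term is dropped and
`tτ coth(tτ) ≥ 1 / 2`. -/
theorem mehlerKernel_le (hm : 1 ≤ m) {t τ : ℝ} (ht : 0 < t) (hτ : 0 ≤ τ) (x y : E m) :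
    mehlerKernel t τ x y ≤ kernelFactor m t τ * Real.exp (-(1 / (8 * t)) * ‖x - y‖ ^ 2) := by
  rcases hτ.eq_or_lt with rfl | hτ
  · rw [mehlerKernel_eq, kernelFactor_zero hm]
    simp
  rw [mehlerKernel_eq]
  refine mul_le_mul_of_nonneg_left (Real.exp_le_exp.2 ?_) (kernelFactor_nonneg ht hτ.le)
  have hs : 0 < t * τ := mul_pos ht hτ
  have h1 : 0 ≤ Real.tanh (t * τ) := by
    rw [Real.tanh_eq_sinh_div_cosh]
    exact div_nonneg (Real.sinh_nonneg_iff.2 hs.le) (Real.cosh_pos _).le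
  have h2 := le_mul_coth hs
  have h3 : 1 / (8 * t) ≤ τ / 4 * coth (t * τ) := by
    rw [div_le_iff₀ (by positivity)]
    nlinarith
  have h4 := mul_le_mul_of_nonneg_right h3 (sq_nonneg ‖x - y‖)
  have h5 : 0 ≤ τ / 4 * (‖x + y‖ ^ 2 * Real.tanh (t * τ)) := by positivity
  nlinarith

theorem integrable_exp_neg_mul_norm {c : ℝ} (hc : 0 < c) :
    Integrable fun ξ : E n => Real.exp (-c * ‖ξ‖) := by
  have h := (integrable_one_add_norm (E := E n) (μ := volume) (r := (n + 1 : ℕ))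
    (by rw [finrank_euclideanSpace_fin]; push_cast; linarith)).const_mul
      (Real.exp c * (n + 1).factorial / c ^ (n + 1))
  refine h.mono' (Continuous.aestronglyMeasurable (by fun_prop)) (ae_of_all _ fun ξ => ?_)
  rw [Real.norm_of_nonneg (Real.exp_pos _).le, Real.rpow_neg (by positivity), Real.rpow_natCast]
  have h1 := Real.pow_div_factorial_le_exp (c * (1 + ‖ξ‖)) (by positivity) (n + 1)
  rw [mul_pow, div_le_iff₀ (by positivity)] at h1
  have h2 : Real.exp (c * (1 + ‖ξ‖)) = Real.exp c * Real.exp (c * ‖ξ‖) := by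
    rw [← Real.exp_add]; congr 1; ring
  rw [h2] at h1
  rw [neg_mul, Real.exp_neg, ← div_eq_mul_inv, div_div, le_div_iff₀ (by positivity),
    inv_mul_le_iff₀ (Real.exp_pos _)]
  linarith

@[fun_prop]
theorem measurable_tanh : Measurable Real.tanh := by
  have : Real.tanh = fun x => Real.sinh x / Real.cosh x := by
    funext x; exact Real.tanh_eq_sinh_div_cosh x
  rw [this]
  fun_prop

@[fun_prop]
theorem measurable_coth : Measurable coth := by
  unfold coth
  fun_prop

theorem measurable_kernelFactor (m : ℕ) (t : ℝ) : Measurable (kernelFactor m t) := by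
  unfold kernelFactor
  fun_prop

theorem measurable_mehlerKernel (t : ℝ) :
    Measurable fun p : ℝ × E m × E m => mehlerKernel t p.1 p.2.1 p.2.2 := by
  unfold mehlerKernel
  fun_prop

theorem integrable_kernelFactor_pow (hm : 1 ≤ m) {t : ℝ} (ht : 0 < t) {j : ℕ} (hj : 1 ≤ j) :
    Integrable fun ξ : E n => kernelFactor m t ‖ξ‖ ^ j := by
  have hc : 0 < j * (t * m / 2) := by
    have : (1 : ℝ) ≤ m := by exact_mod_cast hm
    have : (1 : ℝ) ≤ j := by exact_mod_cast hj
    positivity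
  refine ((integrable_exp_neg_mul_norm (n := n) hc).const_mul
    (((1 / (2 * Real.pi * t)) ^ ((m : ℝ) / 2)) ^ j)).mono'
    (((measurable_kernelFactor m t).comp measurable_norm).pow_const j).aestronglyMeasurable
    (ae_of_all _ fun ξ => ?_)
  have h0 := kernelFactor_nonneg (m := m) ht (norm_nonneg ξ)
  rw [Real.norm_of_nonneg (pow_nonneg h0 j)]
  refine (pow_le_pow_left₀ h0 (kernelFactor_le hm ht (norm_nonneg ξ)) j).trans_eq ?_
  rw [mul_pow, ← Real.exp_nat_mul]
  congr 2
  ring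

theorem integrable_exp_neg_mul_norm_sub_sq {c : ℝ} (hc : 0 < c) (x : E m) :
    Integrable fun y : E m => Real.exp (-c * ‖x - y‖ ^ 2) := by
  have h := (GaussianFourier.integrable_cexp_neg_mul_sq_norm_add (V := E m) (b := (c : ℂ))
    (by simpa using hc) 0 0).norm
  have h' : Integrable fun y : E m => Real.exp (-c * ‖y‖ ^ 2) := by
    refine h.congr (ae_of_all _ fun y => ?_)
    simp only [zero_mul, add_zero]
    rw [← Complex.ofReal_neg, ← Complex.ofReal_pow, ← Complex.ofReal_mul,
      ← Complex.ofReal_exp, Complex.norm_real, Real.norm_of_nonneg (Real.exp_pos _).le]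
  exact h'.comp_sub_left x

/-- The square-integrable majorant of the Mehler kernel. -/
theorem memLp_majorant (hm : 1 ≤ m) {t : ℝ} (ht : 0 < t) (x : E m) :
    MemLp (fun p : E m × E n => Real.exp (-(1 / (8 * t)) * ‖x - p.1‖ ^ 2) *
      kernelFactor m t ‖p.2‖) 2 (volume.prod volume) := by
  have hmeas : Measurable fun p : E m × E n => Real.exp (-(1 / (8 * t)) * ‖x - p.1‖ ^ 2) *
      kernelFactor m t ‖p.2‖ := by
    have := measurable_kernelFactor m t
    fun_prop
  rw [memLp_two_iff_integrable_sq hmeas.aestronglyMeasurable]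
  have h := (integrable_exp_neg_mul_norm_sub_sq (c := 2 * (1 / (8 * t))) (by positivity) x).mul_prod
    (integrable_kernelFactor_pow (n := n) hm ht one_le_two)
  refine h.congr (ae_of_all _ fun p => ?_)
  simp only [mul_pow, ← Real.exp_nat_mul]
  congr 2
  push_cast
  ring

theorem memLp_mehlerKernel (hm : 1 ≤ m) {t : ℝ} (ht : 0 < t) (x : E m) :
    MemLp (fun p : E m × E n => mehlerKernel t ‖p.2‖ x p.1) 2 (volume.prod volume) := by
  refine (memLp_majorant hm ht x).of_le ?_ (ae_of_all _ fun p => ?_)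
  · exact ((measurable_mehlerKernel t).comp
      (by fun_prop : Measurable fun p : E m × E n => (‖p.2‖, x, p.1))).aestronglyMeasurable
  · rw [Real.norm_of_nonneg (mehlerKernel_nonneg ht (norm_nonneg _) _ _), norm_mul,
      Real.norm_of_nonneg (Real.exp_pos _).le,
      Real.norm_of_nonneg (kernelFactor_nonneg ht (norm_nonneg _)), mul_comm]
    exact mehlerKernel_le hm ht (norm_nonneg _) _ _

end KernelBounds

/-! ### The heat kernel as a Fourier transform of the Mehler kernel -/

section HeatKernel

variable {m n : ℕ}

/-- The function of `ξ` whose Fourier transform is the heat kernel. -/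
def kernelSymbol (t : ℝ) (x : E m × E n) (y' : E m) (ξ : E n) : ℂ :=
  Complex.exp (Complex.I * (inner ℝ x.2 ξ : ℝ)) * (mehlerKernel t ‖ξ‖ x.1 y' : ℂ)

theorem norm_kernelSymbol {t : ℝ} (ht : 0 < t) (x : E m × E n) (y' : E m) (ξ : E n) :
    ‖kernelSymbol t x y' ξ‖ = mehlerKernel t ‖ξ‖ x.1 y' := by
  rw [kernelSymbol, norm_mul, mul_comm Complex.I, Complex.norm_exp_ofReal_mul_I, one_mul,
    Complex.norm_real, Real.norm_of_nonneg (mehlerKernel_nonneg ht (norm_nonneg _) _ _)]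

theorem measurable_kernelSymbol (t : ℝ) :
    Measurable fun p : (E m × E n) × E m × E n => kernelSymbol t p.1 p.2.1 p.2.2 := by
  have h := (measurable_mehlerKernel (m := m) t).comp
    (by fun_prop : Measurable fun p : (E m × E n) × E m × E n => (‖p.2.2‖, p.1.1, p.2.1))
  unfold kernelSymbol
  refine Measurable.mul ?_ (Complex.measurable_ofReal.comp h)
  refine Complex.measurable_exp.comp (Measurable.const_mul (Complex.measurable_ofReal.comp ?_) _)
  exact Measurable.inner (by fun_prop) (by fun_prop)

theorem measurable_kernelSymbol_right (t : ℝ) (x : E m × E n) (y' : E m) :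
    Measurable (kernelSymbol t x y') := by
  have h : Measurable fun ξ : E n => mehlerKernel t ‖ξ‖ x.1 y' :=
    (measurable_mehlerKernel (m := m) t).comp
      (measurable_norm.prodMk (measurable_const (a := (x.1, y'))))
  refine Measurable.mul ?_ (Complex.measurable_ofReal.comp h)
  exact Complex.measurable_exp.comp
    ((Complex.measurable_ofReal.comp (measurable_const.inner measurable_id)).const_mul _)

theorem memLp_kernelSymbol_prod (hm : 1 ≤ m) {t : ℝ} (ht : 0 < t) (x : E m × E n) :
    MemLp (fun p : E m × E n => kernelSymbol t x p.1 p.2) 2 (volume.prod volume) := by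
  refine (memLp_mehlerKernel hm ht x.1).of_le ?_ (ae_of_all _ fun p => ?_)
  · exact ((measurable_kernelSymbol t).comp measurable_prodMk_left).aestronglyMeasurable
  · rw [norm_kernelSymbol ht]
    exact le_abs_self _

theorem kernelSymbol_norm_le (hm : 1 ≤ m) {t : ℝ} (ht : 0 < t) (x : E m × E n) (y' : E m)
    (ξ : E n) : ‖kernelSymbol t x y' ξ‖ ≤ kernelFactor m t ‖ξ‖ := by
  rw [norm_kernelSymbol ht]
  refine (mehlerKernel_le hm ht (norm_nonneg _) _ _).trans
    (mul_le_of_le_one_right (kernelFactor_nonneg ht (norm_nonneg _)) (Real.exp_le_one_iff.2 ?_))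
  have : 0 ≤ 1 / (8 * t) * ‖x.1 - y'‖ ^ 2 := by positivity
  linarith

theorem integrable_kernelSymbol (hm : 1 ≤ m) {t : ℝ} (ht : 0 < t) (x : E m × E n) (y' : E m) :
    Integrable (kernelSymbol t x y') := by
  have h := integrable_kernelFactor_pow (n := n) hm ht le_rfl
  simp only [pow_one] at h
  exact h.mono' (measurable_kernelSymbol_right t x y').aestronglyMeasurable
    (ae_of_all _ fun ξ => kernelSymbol_norm_le hm ht x y' ξ)

theorem memLp_kernelSymbol (hm : 1 ≤ m) {t : ℝ} (ht : 0 < t) (x : E m × E n) (y' : E m) :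
    MemLp (kernelSymbol t x y') 2 := by
  have hk : MemLp (fun ξ : E n => kernelFactor m t ‖ξ‖) 2 := by
    have hmeas : Measurable fun ξ : E n => kernelFactor m t ‖ξ‖ :=
      (measurable_kernelFactor m t).comp measurable_norm
    rw [memLp_two_iff_integrable_sq hmeas.aestronglyMeasurable]
    exact integrable_kernelFactor_pow hm ht one_le_two
  exact hk.of_le (measurable_kernelSymbol_right t x y').aestronglyMeasurable
    (ae_of_all _ fun ξ => (kernelSymbol_norm_le hm ht x y' ξ).trans (le_abs_self _))

/-- The substitution `ξ = tη` in the integrand of the heat kernel. -/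
theorem heatIntegrand_smul {t : ℝ} (ht : 0 < t) (x y : E m × E n) (η : E n) :
    heatIntegrand t x y (t • η) = (((2 * Real.pi * t) ^ ((m : ℝ) / 2) : ℝ) : ℂ) *
      (Complex.exp (-Complex.I * (inner ℝ y.2 η : ℝ)) * kernelSymbol t x y.1 η) := by
  have h0 : 0 ≤ Real.sinh (2 * (t * ‖η‖)) := Real.sinh_nonneg_iff.2 (by positivity)
  have h1 : (t * ‖η‖ / Real.sinh (2 * (t * ‖η‖))) ^ ((m : ℝ) / 2) =
      (2 * Real.pi * t) ^ ((m : ℝ) / 2) * kernelFactor m t ‖η‖ := by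
    rw [kernelFactor, ← Real.mul_rpow (by positivity) (by positivity)]
    congr 1
    rcases h0.eq_or_lt with h | h
    · simp [← h]
    · field_simp
  have h2 : t * ‖η‖ / (4 * t) = ‖η‖ / 4 := by field_simp
  have h3 : Complex.exp (Complex.I * ((1 / t * inner ℝ (x.2 - y.2) (t • η) : ℝ) : ℂ)) =
      Complex.exp (-Complex.I * (inner ℝ y.2 η : ℝ)) *
        Complex.exp (Complex.I * (inner ℝ x.2 η : ℝ)) := by
    rw [← Complex.exp_add, inner_smul_right, inner_sub_left, ← mul_assoc, one_div,
      inv_mul_cancel₀ ht.ne', one_mul]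
    congr 1
    push_cast
    ring
  rw [heatIntegrand, norm_smul, Real.norm_of_nonneg ht.le, h3, h1, h2, kernelSymbol,
    mehlerKernel_eq]
  push_cast
  ring

/-- Absolute convergence of the integral defining the heat kernel. -/
theorem integrable_heatIntegrand (hm : 1 ≤ m) {t : ℝ} (ht : 0 < t) (x y : E m × E n) :
    Integrable (heatIntegrand t x y) := by
  rw [← integrable_comp_smul_iff volume (heatIntegrand t x y) ht.ne']
  simp only [heatIntegrand_smul ht]
  refine Integrable.const_mul ?_ _
  refine (integrable_kernelSymbol hm ht x y.1).mono ?_ (ae_of_all _ fun ξ => ?_)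
  · exact AEStronglyMeasurable.mul (Continuous.aestronglyMeasurable (by fun_prop))
      (measurable_kernelSymbol_right t x y.1).aestronglyMeasurable
  · rw [norm_mul, neg_mul, ← mul_neg, ← Complex.ofReal_neg, mul_comm Complex.I,
      Complex.norm_exp_ofReal_mul_I, one_mul]

/-- The heat kernel is, up to the unitary constant, the unitary Fourier transform of
`kernelSymbol`. -/
theorem heatKernel_eq {t : ℝ} (ht : 0 < t) (x y : E m × E n) :
    heatKernel t x y = (unitaryConst n : ℂ) * ((unitaryConst n : ℂ) *
      ∫ ξ, Complex.exp (-Complex.I * (inner ℝ y.2 ξ : ℝ)) * kernelSymbol t x y.1 ξ) := by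
  have h := Measure.integral_comp_smul (volume : Measure (E n)) (heatIntegrand t x y) t
  rw [finrank_euclideanSpace_fin, abs_of_pos (by positivity), Complex.real_smul] at h
  simp only [heatIntegrand_smul ht] at h
  rw [integral_const_mul] at h
  set J := ∫ ξ, Complex.exp (-Complex.I * (inner ℝ y.2 ξ : ℝ)) * kernelSymbol t x y.1 ξ
  have h' : ∫ ξ, heatIntegrand t x y ξ =
      ((t ^ n * (2 * Real.pi * t) ^ ((m : ℝ) / 2) : ℝ) : ℂ) * J := by
    rw [Complex.ofReal_mul, mul_assoc, h, ← mul_assoc, ← Complex.ofReal_mul,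
      mul_inv_cancel₀ (by positivity)]
    simp
  have hc : (2 * Real.pi * t) ^ (-((m : ℝ) + 2 * n) / 2) *
      (t ^ n * (2 * Real.pi * t) ^ ((m : ℝ) / 2)) = unitaryConst n * unitaryConst n := by
    have e1 : unitaryConst n * unitaryConst n = ((2 * Real.pi) ^ n)⁻¹ :=
      eq_inv_of_mul_eq_one_left unitaryConst_sq
    have e2 : (2 * Real.pi * t) ^ (-((m : ℝ) + 2 * n) / 2) *
        (2 * Real.pi * t) ^ ((m : ℝ) / 2) = ((2 * Real.pi * t) ^ n)⁻¹ := by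
      rw [← Real.rpow_add (by positivity), ← Real.rpow_natCast,
        ← Real.rpow_neg (by positivity)]
      congr 1
      ring
    rw [e1, mul_left_comm, e2, mul_pow _ t]
    field_simp
  rw [heatKernel, h', ← mul_assoc, ← Complex.ofReal_mul, hc, Complex.ofReal_mul, mul_assoc]

theorem measurable_heatKernel (t : ℝ) :
    Measurable fun q : (E m × E n) × (E m × E n) => heatKernel t q.1 q.2 := by
  unfold heatKernel
  refine Measurable.const_mul (StronglyMeasurable.measurable ?_) _
  refine StronglyMeasurable.integral_prod_right' (f := fun p : ((E m × E n) × (E m × E n)) × E n =>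
    heatIntegrand t p.1.1 p.1.2 p.2) (Measurable.stronglyMeasurable ?_)
  unfold heatIntegrand
  refine Measurable.mul ?_ (Complex.measurable_ofReal.comp (by fun_prop))
  refine Complex.measurable_exp.comp (Measurable.const_mul (Complex.measurable_ofReal.comp ?_) _)
  exact (Measurable.inner (by fun_prop) (by fun_prop)).const_mul _

/-- The heat kernel is square-integrable in `y`, by Plancherel in `y''` for each fixed `y'`. -/
theorem memLp_heatKernel (hm : 1 ≤ m) {t : ℝ} (ht : 0 < t) (x : E m × E n) :
    MemLp (heatKernel t x) 2 (volume.prod volume) := by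
  have hmeas : AEStronglyMeasurable (heatKernel t x) ((volume : Measure (E m)).prod volume) :=
    ((measurable_heatKernel (m := m) (n := n) t).comp measurable_prodMk_left).aestronglyMeasurable
  have hs := memLp_kernelSymbol_prod hm ht x
  have h : eLpNorm (heatKernel t x) 2 (volume.prod volume) =
      eLpNorm (fun p : E m × E n => (unitaryConst n : ℂ) * kernelSymbol t x p.1 p.2) 2
        (volume.prod volume) := by
    refine eLpNorm_two_prod_congr hmeas (hs.1.const_mul _) (ae_of_all _ fun y' => ?_)
    have h1 := memLp_kernelSymbol hm ht x y'
    rw [eLpNorm_two_eq_iff]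
    have e : ∀ᵐ v : E n, heatKernel t x (y', v) = (unitaryConst n : ℂ) *
        fourierL2 h1.toLp v := by
      filter_upwards [fourierL2_toLp (integrable_kernelSymbol hm ht x y') h1] with v hv
      rw [heatKernel_eq ht, hv]
    have e' : ∫⁻ v : E n, ‖heatKernel t x (y', v)‖ₑ ^ 2 =
        ∫⁻ v : E n, ‖(unitaryConst n : ℂ)‖ₑ ^ 2 * ‖fourierL2 h1.toLp v‖ₑ ^ 2 := by
      refine lintegral_congr_ae ?_
      filter_upwards [e] with v hv
      rw [hv, enorm_mul, mul_pow]
    rw [e', lintegral_const_mul'' _ ((aestronglyMeasurable_fourierL2 _).enorm.pow_const 2),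
      lintegral_fourierL2]
    simp only [enorm_mul, mul_pow]
    rw [lintegral_const_mul'' _ (h1.1.enorm.pow_const 2)]
    congr 1
    refine lintegral_congr_ae ?_
    filter_upwards [h1.coeFn_toLp] with v hv
    rw [hv]
  exact ⟨hmeas, by rw [h]; exact (hs.const_mul _).2⟩

theorem integrable_heatKernel_mul (hm : 1 ≤ m) {t : ℝ} (ht : 0 < t) (x : E m × E n)
    (f : L2 m n) : Integrable fun y => heatKernel t x y * f y :=
  (memLp_heatKernel hm ht x).integrable_mul (Lp.memLp f)

end HeatKernel

/-! ### The operator `exp(-t𝔾)` -/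

section Operator

variable {m n : ℕ}

theorem ae_memLp_slice_snd (F : L2 m n) : ∀ᵐ ξ : E n, MemLp (fun x : E m => F (x, ξ)) 2 := by
  have h : MemLp (fun p : E n × E m => F p.swap) 2 (volume.prod volume) :=
    (Lp.memLp F).comp_measurePreserving (Measure.measurePreserving_swap)
  exact ae_memLp_slice h

theorem ae_norm_pos (hn : 1 ≤ n) : ∀ᵐ ξ : E n, 0 < ‖ξ‖ := by
  have : Nonempty (Fin n) := ⟨⟨0, hn⟩⟩
  have : Nontrivial (E n) := inferInstance
  filter_upwards [Measure.ae_ne (volume : Measure (E n)) 0] with ξ hξ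
  exact norm_pos_iff.2 hξ

theorem stronglyMeasurable_mehlerOp (t : ℝ) (F : L2 m n) :
    StronglyMeasurable fun p : E m × E n => mehlerOp t ‖p.2‖ (fun y => F (y, p.2)) p.1 := by
  unfold mehlerOp
  have hF := Lp.stronglyMeasurable F
  refine StronglyMeasurable.integral_prod_right' (f := fun q : (E m × E n) × E m =>
    (mehlerKernel t ‖q.1.2‖ q.1.1 q.2 : ℂ) * F (q.2, q.1.2)) ?_
  have h : Measurable fun q : (E m × E n) × E m => mehlerKernel t ‖q.1.2‖ q.1.1 q.2 :=
    (measurable_mehlerKernel t).comp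
      (by fun_prop : Measurable fun q : (E m × E n) × E m => (‖q.1.2‖, q.1.1, q.2))
  exact (Complex.measurable_ofReal.comp h).stronglyMeasurable.mul
    (hF.comp_measurable (by fun_prop : Measurable fun q : (E m × E n) × E m => (q.2, q.1.2)))

theorem stronglyMeasurable_hermiteCoeff (F : L2 m n) (k : Fin m → ℕ) :
    StronglyMeasurable fun ξ : E n => hermiteCoeff ‖ξ‖ (fun y => F (y, ξ)) k := by
  unfold hermiteCoeff
  have hF := Lp.stronglyMeasurable F
  refine StronglyMeasurable.integral_prod_right' (f := fun q : E n × E m =>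
    F (q.2, q.1) * (scaledHermite k ‖q.1‖ q.2 : ℂ)) ?_
  have h : Measurable fun q : E n × E m => scaledHermite k ‖q.1‖ q.2 := by
    unfold scaledHermite
    have hc : Continuous (hermiteFunMulti k) := by
      unfold hermiteFunMulti
      have := fun j => continuous_hermiteFun j
      fun_prop
    exact Measurable.mul (by fun_prop) (hc.measurable.comp (by fun_prop))
  exact (hF.comp_measurable measurable_swap).mul
    (Complex.measurable_ofReal.comp h).stronglyMeasurable

/-- The Hermite coefficients of the slices as a function on `Γ`. -/
def coeffFun (F : L2 m n) (p : (Fin m → ℕ) × E n) : ℂ :=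
  hermiteCoeff ‖p.2‖ (fun y => F (y, p.2)) p.1

theorem measurable_coeffFun (F : L2 m n) : Measurable (coeffFun F) :=
  measurable_from_prod_countable_right fun k => (stronglyMeasurable_hermiteCoeff F k).measurable

theorem lintegral_sq_swap (F : L2 m n) :
    ∫⁻ ξ : E n, ∫⁻ x : E m, ‖F (x, ξ)‖ₑ ^ 2 < ⊤ := by
  have h : ∫⁻ p, ‖F p‖ₑ ^ 2 ∂(volume : Measure (E m)).prod (volume : Measure (E n)) < ⊤ :=
    (memLp_two_iff_lintegral (Lp.aestronglyMeasurable F)).1 (Lp.memLp F)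
  rwa [lintegral_prod_symm _
    ((Lp.stronglyMeasurable F).aestronglyMeasurable.enorm.pow_const 2)] at h

theorem memLp_coeffFun (hn : 1 ≤ n) (F : L2 m n) :
    MemLp (coeffFun F) 2 (gammaMeasure m n) := by
  have hm := measurable_coeffFun F
  rw [memLp_two_iff_lintegral hm.aestronglyMeasurable, gammaMeasure,
    lintegral_prod_symm _ (hm.aestronglyMeasurable.enorm.pow_const 2)]
  simp only [lintegral_count]
  refine lt_of_le_of_lt (lintegral_mono_ae ?_) (lintegral_sq_swap F)
  filter_upwards [ae_memLp_slice_snd F, ae_norm_pos hn] with ξ h1 h2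
  have h := tsum_hermiteCoeff_le h2 h1
  simpa only [coeffFun] using h

theorem memLp_mehlerOp (hn : 1 ≤ n) {t : ℝ} (ht : 0 < t) (F : L2 m n) :
    MemLp (fun p : E m × E n => mehlerOp t ‖p.2‖ (fun y => F (y, p.2)) p.1) 2
      (volume.prod volume) := by
  have hm := stronglyMeasurable_mehlerOp t F
  rw [memLp_two_iff_lintegral hm.aestronglyMeasurable,
    lintegral_prod_symm _ (hm.aestronglyMeasurable.enorm.pow_const 2)]
  refine lt_of_le_of_lt (lintegral_mono_ae ?_) (lintegral_sq_swap F)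
  filter_upwards [ae_memLp_slice_snd F, ae_norm_pos hn] with ξ h1 h2
  exact lintegral_mehlerOp_le ht h2 h1

theorem exp_Θ_eq (t : ℝ) (k : Fin m → ℕ) (ξ : E n) :
    Real.exp (-t * Θ (k, ξ)) = heatFactor t ‖ξ‖ k := rfl

theorem measurable_heatFactor (t : ℝ) :
    Measurable fun p : (Fin m → ℕ) × E n => heatFactor t ‖p.2‖ p.1 :=
  measurable_from_prod_countable_right fun k => by unfold heatFactor; fun_prop

theorem heatFactor_le_one {t τ : ℝ} (ht : 0 < t) (hτ : 0 ≤ τ) (k : Fin m → ℕ) :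
    heatFactor t τ k ≤ 1 := by
  refine Real.exp_le_one_iff.2 ?_
  have : 0 ≤ (2 * ((∑ i, k i : ℕ) : ℝ) + m) * τ := by positivity
  nlinarith

/-- An almost everywhere statement on `Γ` holds at almost every frequency for all `k`. -/
theorem ae_gamma {p : (Fin m → ℕ) × E n → Prop} (h : ∀ᵐ q ∂gammaMeasure m n, p q) :
    ∀ᵐ ξ : E n, ∀ k, p (k, ξ) :=
  ae_all_iff.2 (Measure.ae_count_iff.1 (Measure.ae_ae_of_ae_prod h))

/-- Every `f ∈ L²` lies in the domain of `exp(-t𝔾)`. The transforms are built explicitly: `Φ` from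
the Hermite coefficients of the slices of the partial Fourier transform `F`, `Ψ = e^{-tΘ} Φ`, and
`U` from the Mehler operator applied to the slices of `F`. -/
theorem exists_heatGraph (hn : 1 ≤ n) {t : ℝ} (ht : 0 < t) (f : L2 m n) :
    ∃ g : L2 m n, HeatGraph t f g := by
  obtain ⟨F, hF⟩ := exists_isPartialFourier f
  have hΦ := memLp_coeffFun hn F
  have hΨ : MemLp (fun p => (heatFactor t ‖p.2‖ p.1 : ℂ) * coeffFun F p) 2
      (gammaMeasure m n) := by
    refine hΦ.of_le ?_ (ae_of_all _ fun p => ?_)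
    · exact ((Complex.measurable_ofReal.comp (measurable_heatFactor t)).mul
        (measurable_coeffFun F)).aestronglyMeasurable
    · rw [norm_mul, Complex.norm_real, Real.norm_of_nonneg (heatFactor_pos _ _ _).le]
      exact mul_le_of_le_one_left (norm_nonneg _) (heatFactor_le_one ht (norm_nonneg _) _)
  have hU := memLp_mehlerOp hn ht F
  obtain ⟨g, hg⟩ := exists_isPartialFourier_right (m := m) (n := n) hU.toLp
  refine ⟨g, hΦ.toLp, hΨ.toLp, ⟨F, hF, ?_⟩, ?_, hU.toLp, ?_, hg⟩
  · filter_upwards [ae_gamma hΦ.coeFn_toLp] with ξ hξ k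
    exact hξ k
  · filter_upwards [hΦ.coeFn_toLp, hΨ.coeFn_toLp] with p h1 h2
    rw [h1, h2]
    rfl
  · have hUs : ∀ᵐ ξ : E n, ∀ᵐ x : E m, (hU.toLp : L2 m n) (x, ξ) =
        mehlerOp t ‖ξ‖ (fun y => F (y, ξ)) x := by
      have h := Measure.measurePreserving_swap.quasiMeasurePreserving.ae hU.coeFn_toLp
      exact Measure.ae_ae_of_ae_prod h
    filter_upwards [hUs, ae_gamma hΨ.coeFn_toLp, ae_memLp_slice_snd F, ae_norm_pos hn]
      with ξ h1 h2 h3 h4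
    refine (tendsto_eLpNorm_mehlerOp_sub ht h4 h3).congr fun s => eLpNorm_congr_ae ?_
    filter_upwards [h1] with x hx
    rw [hx]
    simp only [h2]
    rfl

/-- On almost every fibre, `exp(-t𝔾)` acts by the Mehler operator. -/
theorem ae_eq_mehlerOp (hn : 1 ≤ n) {t : ℝ} (ht : 0 < t) {F U : L2 m n} {Φ Ψ : L2Γ m n}
    (hΦ : ∀ᵐ ξ : E n, ∀ k : Fin m → ℕ,
      Φ (k, ξ) = ∫ x' : E m, F (x', ξ) * (scaledHermite k ‖ξ‖ x' : ℂ))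
    (hΨ : ∀ᵐ p ∂(gammaMeasure m n), Ψ p = (Real.exp (-t * Θ p) : ℂ) * Φ p)
    (hU : ∀ᵐ ξ : E n, Tendsto
      (fun s : Finset (Fin m → ℕ) => eLpNorm
        (fun x' : E m => U (x', ξ) - ∑ k ∈ s, Ψ (k, ξ) * (scaledHermite k ‖ξ‖ x' : ℂ)) 2 volume)
      atTop (𝓝 0)) :
    ∀ᵐ x : E m, ∀ᵐ ξ : E n, U (x, ξ) = mehlerOp t ‖ξ‖ (fun y => F (y, ξ)) x := by
  have hop := stronglyMeasurable_mehlerOp t F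
  have hUm := Lp.stronglyMeasurable U
  have hset : MeasurableSet {p : E m × E n |
      U (p.1, p.2) = mehlerOp t ‖p.2‖ (fun y => F (y, p.2)) p.1} :=
    measurableSet_eq_fun hUm.measurable hop.measurable
  -- The hypotheses concern almost every `ξ`, so the two quantifiers are exchanged first.
  rw [Measure.ae_ae_comm hset]
  filter_upwards [hΦ, ae_gamma hΨ, hU, ae_memLp_slice_snd F, ae_norm_pos hn] with ξ h1 h2 h3 h4 h5
  have hlim := tendsto_eLpNorm_mehlerOp_sub ht h5 h4
  have e : ∀ k, Ψ (k, ξ) = (heatFactor t ‖ξ‖ k : ℂ) *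
      hermiteCoeff ‖ξ‖ (fun y => F (y, ξ)) k := fun k => by
    rw [h2, h1, exp_Θ_eq, hermiteCoeff]
  simp only [e] at h3
  have hUξ : StronglyMeasurable fun x : E m => U (x, ξ) :=
    hUm.comp_measurable measurable_prodMk_right
  have hopξ : StronglyMeasurable fun x : E m => mehlerOp t ‖ξ‖ (fun y => F (y, ξ)) x := by
    have h := hop.comp_measurable (measurable_prodMk_right (y := ξ))
    simpa only [Function.comp_def] using h
  have hsum : ∀ s : Finset (Fin m → ℕ), Continuous fun x : E m => ∑ k ∈ s,
      (heatFactor t ‖ξ‖ k : ℂ) * hermiteCoeff ‖ξ‖ (fun y => F (y, ξ)) k *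
        (scaledHermite k ‖ξ‖ x : ℂ) := fun s =>
    continuous_finsetSum _ fun k _ => continuous_const.mul
      (Complex.continuous_ofReal.comp (continuous_scaledHermite k ‖ξ‖))
  have hzero : eLpNorm (fun x : E m => U (x, ξ) - mehlerOp t ‖ξ‖ (fun y => F (y, ξ)) x) 2
      volume = 0 := by
    refine le_antisymm (ge_of_tendsto' (x := (atTop : Filter (Finset (Fin m → ℕ))))
      (by simpa using h3.add hlim) fun s => ?_) zero_le
    have hsm := (hsum s).aestronglyMeasurable (μ := volume)
    refine le_trans (le_of_eq ?_) (eLpNorm_sub_le (hUξ.aestronglyMeasurable.sub hsm)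
      (hopξ.aestronglyMeasurable.sub hsm) one_le_two)
    congr 1
    ext x
    simp
  filter_upwards [(eLpNorm_eq_zero_iff (hUξ.sub hopξ).aestronglyMeasurable two_ne_zero).1 hzero]
    with x hx
  exact sub_eq_zero.1 hx

/-- Inverting the partial Fourier transform of the fibrewise Mehler operator yields the heat
kernel. -/
theorem fourierInv_mehlerOp_eq (hm : 1 ≤ m) {t : ℝ} (ht : 0 < t) {f F : L2 m n}
    (hF : IsPartialFourier f F) (x : E m × E n) :
    (unitaryConst n : ℂ) * ∫ ξ, Complex.exp (Complex.I * (inner ℝ x.2 ξ : ℝ)) *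
      mehlerOp t ‖ξ‖ (fun y => F (y, ξ)) x.1 = ∫ y, heatKernel t x y * f y := by
  have hint : Integrable (fun p : E m × E n => kernelSymbol t x p.1 p.2 * F p)
      (volume.prod volume) := (memLp_kernelSymbol_prod hm ht x).integrable_mul (Lp.memLp F)
  have e1 : ∀ ξ : E n, Complex.exp (Complex.I * (inner ℝ x.2 ξ : ℝ)) *
      mehlerOp t ‖ξ‖ (fun y => F (y, ξ)) x.1 =
        ∫ y' : E m, kernelSymbol t x y' ξ * F (y', ξ) := by
    intro ξ
    rw [mehlerOp, ← integral_const_mul]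
    refine integral_congr_ae (ae_of_all _ fun y' => ?_)
    simp only [kernelSymbol]
    ring
  have hprod : ∫ y, heatKernel t x y * f y =
      ∫ y' : E m, ∫ v : E n, heatKernel t x (y', v) * f (y', v) :=
    integral_prod _ (integrable_heatKernel_mul hm ht x f)
  simp only [e1]
  rw [← integral_integral_swap (f := fun (y' : E m) (ξ : E n) => kernelSymbol t x y' ξ * F (y', ξ))
    hint, hprod, ← integral_const_mul]
  refine integral_congr_ae ?_
  filter_upwards [hF] with y' ⟨h, hy⟩
  have e2 : ∫ ξ, kernelSymbol t x y' ξ * F (y', ξ) =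
      ∫ ξ, fourierL2 h.toLp ξ * kernelSymbol t x y' ξ := by
    refine integral_congr_ae ?_
    filter_upwards [hy] with ξ hξ
    rw [hξ, mul_comm]
  simp only [e2]
  rw [integral_fourierL2_mul h.toLp (integrable_kernelSymbol hm ht x y')
    (memLp_kernelSymbol hm ht x y'), ← integral_const_mul]
  refine integral_congr_ae ?_
  filter_upwards [h.coeFn_toLp] with v hv
  rw [hv, heatKernel_eq ht]
  ring

/-- `exp(-t𝔾)` is the integral operator with the heat kernel. -/
theorem heatGraph_apply (hm : 1 ≤ m) (hn : 1 ≤ n) {t : ℝ} (ht : 0 < t) {f g : L2 m n}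
    (h : HeatGraph t f g) : ∀ᵐ x : E m × E n, g x = ∫ y, heatKernel t x y * f y := by
  obtain ⟨Φ, Ψ, ⟨F, hF, hΦ⟩, hΨ, U, hU, hg⟩ := h
  have hfib := ae_eq_mehlerOp hn ht hΦ hΨ hU
  have hmeas : MeasurableSet {x : E m × E n | g x = ∫ y, heatKernel t x y * f y} := by
    refine measurableSet_eq_fun (Lp.stronglyMeasurable g).measurable
      (StronglyMeasurable.measurable ?_)
    exact StronglyMeasurable.integral_prod_right' (f := fun q : (E m × E n) × (E m × E n) =>
      heatKernel t q.1 q.2 * f q.2) ((measurable_heatKernel t).stronglyMeasurable.mul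
        ((Lp.stronglyMeasurable f).comp_measurable measurable_snd))
  refine (Measure.ae_prod_iff_ae_ae hmeas).2 ?_
  filter_upwards [hfib, hg] with x' h1 ⟨hgx, h2⟩
  have hw : (fun ξ : E n => mehlerOp t ‖ξ‖ (fun y => F (y, ξ)) x') =ᵐ[volume]
      fourierL2 hgx.toLp := by
    filter_upwards [h1, h2] with ξ h3 h4
    rw [← h3, h4]
  have hint : Integrable fun ξ : E n => mehlerOp t ‖ξ‖ (fun y => F (y, ξ)) x' := by
    have hk : Integrable (fun p : E m × E n => (mehlerKernel t ‖p.2‖ x' p.1 : ℂ) * F p)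
        (volume.prod volume) := (memLp_mehlerKernel hm ht x').ofReal.integrable_mul (Lp.memLp F)
    exact hk.integral_prod_right
  filter_upwards [hgx.coeFn_toLp, ae_eq_of_fourierL2_eq hw hint] with v h5 h6
  rw [← h5, h6]
  exact fourierInv_mehlerOp_eq hm ht hF (x', v)

end Operator

end Grushin

end

theorem theorem5p1 (d' d'' : ℕ) (hd' : 1 ≤ d') (hd'' : 1 ≤ d'') (t : ℝ) (ht : 0 < t) :
    -- `exp(-t𝔾)` is a well-defined operator on all of `L²(ℝᵈ)`
    (∀ f : Grushin.L2 d' d'', ∃! g : Grushin.L2 d' d'', Grushin.HeatGraph t f g) ∧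
    -- the integral defining `p_t(x, y)` converges absolutely, and `p_t` is measurable
    (∀ x y : Grushin.E d' × Grushin.E d'', Integrable (Grushin.heatIntegrand t x y)) ∧
    Measurable (fun q : (Grushin.E d' × Grushin.E d'') × (Grushin.E d' × Grushin.E d'') =>
      Grushin.heatKernel t q.1 q.2) ∧
    -- `exp(-t𝔾)` is the integral operator with kernel `p_t`
    (∀ f g : Grushin.L2 d' d'', Grushin.HeatGraph t f g →
      (∀ x : Grushin.E d' × Grushin.E d'',
        Integrable (fun y => Grushin.heatKernel t x y * f y)) ∧
      ∀ᵐ x : Grushin.E d' × Grushin.E d'',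
        g x = ∫ y, Grushin.heatKernel t x y * f y) := by
  refine ⟨fun f => ?_, Grushin.integrable_heatIntegrand hd' ht, Grushin.measurable_heatKernel t,
    fun f g h => ⟨fun x => Grushin.integrable_heatKernel_mul hd' ht x f,
      Grushin.heatGraph_apply hd' hd'' ht h⟩⟩
  obtain ⟨g, hg⟩ := Grushin.exists_heatGraph hd'' ht f
  refine ⟨g, hg, fun g' hg' => Lp.ext ?_⟩
  -- the kernel formula determines the image
  filter_upwards [Grushin.heatGraph_apply hd' hd'' ht hg, Grushin.heatGraph_apply hd' hd'' ht hg']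
    with x h1 h2
  rw [h1, h2]
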